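/- **Setting.** Let $n,d\ge 1$, let $f\ne 0$ be a real polynomial in $n$ variables of degree at most $d$, and let $a>0$. Let $f^{\mathsf h}=\sum_\alpha f_\alpha X_0^{d-|\alpha|}X^\alpha$ be its homogenization in degree $d$. For a homogeneous polynomial $F=\sum_\alpha F_\alpha X^\alpha$ of degree $d$ let $\|F\|=\big(\sum_\alpha \binom{d}{\alpha}^{-1}F_\alpha^2\big)^{1/2}$ be its Weyl norm, and put $\|f\|:=\|f^{\mathsf h}\|$. For $y\in\mathbb S^n$ let $$\kappa(F,y)=\frac{\|F\|}{\sqrt{F(y)^2+\|\partial_yF|_{\mathrm T_y\mathbb S^n}\|^2/d}}\in(0,\infty],$$ and for $x\in\mathbb R^n$ let $\kappa_{\mathsf{aff}}(f,x)=\kappa\big(f^{\mathsf h},(1,x)/\sqrt{1+\|x\|^2}\big)$. Write $\partial f$ for the vector of partial derivatives of $f$, and $$\widehat f(x)=\frac{f(x)}{\|f\|(1+\|x\|^2)^{(d-1)/2}},\qquad \widehat{\partial f}(x)=\frac{\partial f(x)}{d\,\|f\|(1+\|x\|^2)^{d/2-1}}.$$ For a (closed, axis-parallel) $n$-cube $J$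 let $m(J)$ be its midpoint and $w(J)>0$ its width. An interval approximation of a map $F$ on $\mathbb R^n$ is a map $\square[F]$ that assigns to each $n$-cube $J$ a set $\square[F](J)\supseteq F(J)$. Given a test on $n$-cubes, the subdivision routine (of the Plantinga–Vegter algorithm) on input $(f,a)$ starts with $\mathcal S=\{[-a,a]^n\}$ and repeatedly replaces each cube of $\mathcal S$ that fails the test by its $2^n$ sub-cubes of half the width, until all cubes of $\mathcal S$ pass. Given interval approximations $\square[hf]$, $\square[h'\partial f]$ for positive functions $h,h'$, the test is $$C_f(J):\quad 0\notin\square[hf](J)\ \text{ or }\ 0\notin\{\langle u,v\rangle: u,v\in\square[h'\partial f](J)\}.$$ The number of cubes in the final subdivision is $\infty$ if the routine does not terminate. $\mathbb E_{x\in[-a,a]^n}$ is the expectation for $x$ uniform in $[-a,a]^n$ (possibly $\infty$), and $\log$ is the logarithm in base $2$. For a polynomial $p$ and a cube with midpoint $c$ and width $w$, the *centered form* of $p$ is the interval with midpoint $p(c)$ and radius $\sum_{\alpha\neq0}\frac{|\partial^\alpha p(c)|}{\alpha!}\left(\frac w2\right)^{|\alpha|}$. **Theorem.** 1. Let $\square[hf]$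 and $\square[h'\partial f]$ be interval approximations of $hf=\widehat f$ and $h'\partial f=\widehat{\partial f}$ such that, for each $n$-cube $J$, all points of $\square[hf](J)$ have distance at most $(1+\sqrt d)\sqrt n\,w(J)/2$ from $\widehat f(m(J))$ and all points of $\square[h'\partial f](J)$ have distance at most $(1+\sqrt{d-1})\,n\,w(J)/2$ from $\widehat{\partial f}(m(J))$. Then the number of $n$-cubes in the final subdivision is at most $$d^n\max\{1,a^n\}\,2^{n\log n+9n/2}\;\mathbb E_{x\in[-a,a]^n}\big(\kappa_{\mathsf{aff}}(f,x)^n\big).$$ 2. Let the interval approximations be those given by Taylor expansion at the midpoint (Burr–Gao–Tsigaridas): $\square[f](J)$ is contained in the centered form of $f$ on $J$, and either $\square[\partial f](J)$ is contained in the box formed by the centered forms of the partial derivatives $\partial_i f$ on $J$ (with the test $C_f$, $h=h'=1$), or $\{\langle u,v\rangle: u,v\in\square[\partial f](J)\}$ is replaced in the test by a set that contains all $\langle\partial f(x),\partial f(y)\rangle$, $x,y\in J$, and is contained in the centered form of the polynomial $g_f(X,Y)=\langle\partial f(X),\partial f(Y)\rangle$ on the $2n$-cube $J\times J$. In both cases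 the number of $n$-cubes in the final subdivision is at most $$d^{2n}\max\{1,a^n\}\,2^{3n^2+2n}\;\mathbb E_{x\in[-a,a]^n}\big(\kappa_{\mathsf{aff}}(f,x)^n\big).$$ -/

import Mathlib

open scoped ENNReal

namespace PV

noncomputable section

/-! ### Cubes and the subdivision routine -/

/-- A nondegenerate closed axis-parallel `n`-cube, given by its midpoint and its width. -/
@[ext]
structure Cube (n : ℕ) where
  mid : EuclideanSpace ℝ (Fin n)
  width : ℝ
  width_pos : 0 < width

/-- The points of a cube. -/
def Cube.toSet {n : ℕ} (J : Cube n) : Set (EuclideanSpace ℝ (Fin n)) :=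
  {x | ∀ i, |x i - J.mid i| ≤ J.width / 2}

/-- The sub-cube of half the width in the corner selected by the signs `ε`. -/
def Cube.child {n : ℕ} (J : Cube n) (ε : Fin n → Bool) : Cube n where
  mid := WithLp.toLp 2 fun i => J.mid i + (if ε i then J.width / 4 else -(J.width / 4))
  width := J.width / 2
  width_pos := half_pos J.width_pos

/-- The initial cube `[-a,a]^n`. -/
def rootCube (n : ℕ) (a : ℝ) (ha : 0 < a) : Cube n where
  mid := 0
  width := 2 * a
  width_pos := by linarith

/-- One round: every cube that passes the test is kept, every other one is replaced by its
`2^n` sub-cubes. -/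
def refine {n : ℕ} (test : Cube n → Prop) (S : Set (Cube n)) : Set (Cube n) :=
  {J | J ∈ S ∧ test J} ∪ {J | ∃ K ∈ S, ¬ test K ∧ ∃ ε, J = K.child ε}

/-- The subdivision after `k` rounds. -/
def subdivision {n : ℕ} (test : Cube n → Prop) (Q : Cube n) : ℕ → Set (Cube n)
  | 0 => {Q}
  | k + 1 => refine test (subdivision test Q k)

/-- The routine has stopped after `k` rounds: all the cubes pass the test. -/
def StoppedAt {n : ℕ} (test : Cube n → Prop) (Q : Cube n) (k : ℕ) : Prop :=
  ∀ J ∈ subdivision test Q k, test J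

open Classical in
/-- The number of cubes in the final subdivision; it is `⊤` if the routine never stops. -/
def numCubes {n : ℕ} (test : Cube n → Prop) (Q : Cube n) : ℕ∞ :=
  if h : ∃ k, StoppedAt test Q k then (subdivision test Q (Nat.find h)).encard else ⊤

/-! ### Interval approximations and the test -/

/-- `B` is an interval approximation of `F`. The values of `B` may be any sets, in particular
intervals, cubes or boxes. -/
def IsIntervalApprox {n : ℕ} {E : Type*} (F : EuclideanSpace ℝ (Fin n) → E)
    (B : Cube n → Set E) : Prop :=
  ∀ J : Cube n, F '' J.toSet ⊆ B J

/-- The condition `C_f(J)`: `0 ∉ B J`, or `0` is not among the `⟨u, v⟩` with `u, v ∈ D J`. -/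
def pvTest {n : ℕ} (B : Cube n → Set ℝ) (D : Cube n → Set (EuclideanSpace ℝ (Fin n)))
    (J : Cube n) : Prop :=
  (0 : ℝ) ∉ B J ∨ (0 : ℝ) ∉ Set.image2 (fun u v => inner ℝ u v) (D J) (D J)

/-! ### Polynomials, homogenization, Weyl norm and condition number -/

/-- The homogenization `∑_α f_α X_0^(d-|α|) X^α` of `f` in degree `d`, for `deg f ≤ d`. -/
def homogenize {n : ℕ} (d : ℕ) (f : MvPolynomial (Fin n) ℝ) : MvPolynomial (Fin (n + 1)) ℝ :=
  ∑ α ∈ f.support, MvPolynomial.monomial (Finsupp.cons (d - α.degree) α) (f.coeff α)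

/-- The Weyl norm of a homogeneous polynomial. -/
def weylNorm {m : ℕ} (F : MvPolynomial (Fin m) ℝ) : ℝ :=
  √(∑ α ∈ F.support, (F.coeff α) ^ 2 / (α.multinomial : ℝ))

/-- The Weyl norm on polynomials of degree at most `d`. -/
def affWeylNorm {n : ℕ} (d : ℕ) (f : MvPolynomial (Fin n) ℝ) : ℝ :=
  weylNorm (homogenize d f)

/-- Evaluation at a point of Euclidean space. -/
def evalAt {m : ℕ} (F : MvPolynomial (Fin m) ℝ) (y : EuclideanSpace ℝ (Fin m)) : ℝ :=
  MvPolynomial.eval (fun i => y i) F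

/-- The polynomial map of the partial derivatives. -/
def grad {n : ℕ} (f : MvPolynomial (Fin n) ℝ) (x : EuclideanSpace ℝ (Fin n)) :
    EuclideanSpace ℝ (Fin n) :=
  WithLp.toLp 2 fun i => evalAt (MvPolynomial.pderiv i f) x

/-- The map `x ↦ (1, x) / √(1 + ‖x‖²)` onto the open upper half sphere. -/
def sphereMap {n : ℕ} (x : EuclideanSpace ℝ (Fin n)) : EuclideanSpace ℝ (Fin (n + 1)) :=
  (√(1 + ‖x‖ ^ 2))⁻¹ • WithLp.toLp 2 (Fin.cons 1 fun i => x i)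

/-- The norm of the tangent map of `F` at the unit vector `y`, restricted to the tangent space
`y^⊥` of the sphere. -/
def tangentNorm {m : ℕ} (F : MvPolynomial (Fin m) ℝ) (y : EuclideanSpace ℝ (Fin m)) : ℝ :=
  ‖(fderiv ℝ (evalAt F) y).comp (Submodule.span ℝ {y})ᗮ.subtypeL‖

/-- The local condition number of the form `F ≠ 0` of degree `d` at the unit vector `y`; it is
`⊤` at a singular zero. -/
def kappa {m : ℕ} (d : ℕ) (F : MvPolynomial (Fin m) ℝ) (y : EuclideanSpace ℝ (Fin m)) : ℝ≥0∞ :=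
  ENNReal.ofReal (weylNorm F) /
    ENNReal.ofReal (√((evalAt F y) ^ 2 + (tangentNorm F y) ^ 2 / d))

/-- The local affine condition number. -/
def kappaAff {n : ℕ} (d : ℕ) (f : MvPolynomial (Fin n) ℝ) (x : EuclideanSpace ℝ (Fin n)) :
    ℝ≥0∞ :=
  kappa d (homogenize d f) (sphereMap x)

/-- The expectation of `κ_aff(f,x)^n` for `x` uniform in `[-a,a]^n`. -/
def meanKappaPow {n : ℕ} (d : ℕ) (f : MvPolynomial (Fin n) ℝ) (a : ℝ) : ℝ≥0∞ :=
  MeasureTheory.laverage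
    (MeasureTheory.volume.restrict {x : EuclideanSpace ℝ (Fin n) | ∀ i, x i ∈ Set.Icc (-a) a})
    (fun x => kappaAff d f x ^ n)

/-! ### Interval approximations of the linearized maps -/

/-- `f(x) / (‖f‖ (1 + ‖x‖²)^((d-1)/2))`. -/
def hatF {n : ℕ} (d : ℕ) (f : MvPolynomial (Fin n) ℝ) (x : EuclideanSpace ℝ (Fin n)) : ℝ :=
  evalAt f x / (affWeylNorm d f * (1 + ‖x‖ ^ 2) ^ (((d : ℝ) - 1) / 2))

/-- `∂f(x) / (d ‖f‖ (1 + ‖x‖²)^(d/2-1))`. -/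
def hatGrad {n : ℕ} (d : ℕ) (f : MvPolynomial (Fin n) ℝ) (x : EuclideanSpace ℝ (Fin n)) :
    EuclideanSpace ℝ (Fin n) :=
  ((d : ℝ) * affWeylNorm d f * (1 + ‖x‖ ^ 2) ^ ((d : ℝ) / 2 - 1))⁻¹ • grad f x

/-- Every point of `B J` has distance at most `(1 + √d) √n w(J) / 2` from the value of the
linearized map at the midpoint. -/
def FunBound {n : ℕ} (d : ℕ) (f : MvPolynomial (Fin n) ℝ) (B : Cube n → Set ℝ) : Prop :=
  ∀ J : Cube n, ∀ t ∈ B J, dist t (hatF d f J.mid) ≤ (1 + √(d : ℝ)) * √(n : ℝ) * J.width / 2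

/-- Every point of `D J` has distance at most `(1 + √(d-1)) n w(J) / 2` from the value of the
linearized gradient at the midpoint. -/
def GradBound {n : ℕ} (d : ℕ) (f : MvPolynomial (Fin n) ℝ)
    (D : Cube n → Set (EuclideanSpace ℝ (Fin n))) : Prop :=
  ∀ J : Cube n, ∀ v ∈ D J,
    dist v (hatGrad d f J.mid) ≤ (1 + √((d : ℝ) - 1)) * n * J.width / 2

/-! ### Interval approximations by Taylor expansion at the midpoint -/

/-- The Taylor coefficient `∂^α p(c) / α!`, that is, the coefficient of `X^α` in `p(c + X)`. -/
def taylorCoeff {σ : Type*} (p : MvPolynomial σ ℝ) (c : σ → ℝ) (α : σ →₀ ℕ) : ℝ :=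
  (MvPolynomial.bind₁ (fun i => MvPolynomial.X i + MvPolynomial.C (c i)) p).coeff α

open Classical in
/-- `∑_{α ≠ 0} |∂^α p(c)| / α! · (w/2)^|α|`. -/
def taylorRadius {σ : Type*} (p : MvPolynomial σ ℝ) (c : σ → ℝ) (w : ℝ) : ℝ :=
  ∑ α ∈ (MvPolynomial.bind₁ (fun i => MvPolynomial.X i + MvPolynomial.C (c i)) p).support.erase 0,
    |taylorCoeff p c α| * (w / 2) ^ α.degree

/-- The centered form of `p` on the cube with midpoint `c` and width `w`: the interval with
midpoint `p(c)` and radius `∑_{α ≠ 0} |∂^α p(c)| / α! · (w/2)^|α|`. -/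
def taylorForm {σ : Type*} (p : MvPolynomial σ ℝ) (c : σ → ℝ) (w : ℝ) : Set ℝ :=
  Set.Icc (MvPolynomial.eval c p - taylorRadius p c w) (MvPolynomial.eval c p + taylorRadius p c w)

/-- The polynomial `g_f(X,Y) = ⟨∂f(X), ∂f(Y)⟩` in `2n` variables. -/
def gradProd {n : ℕ} (f : MvPolynomial (Fin n) ℝ) : MvPolynomial (Fin n ⊕ Fin n) ℝ :=
  ∑ i, MvPolynomial.rename Sum.inl (MvPolynomial.pderiv i f) *
    MvPolynomial.rename Sum.inr (MvPolynomial.pderiv i f)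

/-- `B` is at least as tight as the centered form of `f`. -/
def TaylorFun {n : ℕ} (f : MvPolynomial (Fin n) ℝ) (B : Cube n → Set ℝ) : Prop :=
  ∀ J : Cube n, B J ⊆ taylorForm f (fun i => J.mid i) J.width

/-- `D` is at least as tight as the box of the centered forms of the partial derivatives. -/
def TaylorGrad {n : ℕ} (f : MvPolynomial (Fin n) ℝ)
    (D : Cube n → Set (EuclideanSpace ℝ (Fin n))) : Prop :=
  ∀ J : Cube n, ∀ v ∈ D J, ∀ i,
    v i ∈ taylorForm (MvPolynomial.pderiv i f) (fun j => J.mid j) J.width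

/-- `G` encloses the values `⟨∂f(x), ∂f(y)⟩` for `x, y ∈ J`. -/
def IsGradProdApprox {n : ℕ} (f : MvPolynomial (Fin n) ℝ) (G : Cube n → Set ℝ) : Prop :=
  ∀ J : Cube n, ∀ x ∈ J.toSet, ∀ y ∈ J.toSet, inner ℝ (grad f x) (grad f y) ∈ G J

/-- `G` is at least as tight as the centered form of `g_f` on the `2n`-cube `J × J`. -/
def TaylorGradProd {n : ℕ} (f : MvPolynomial (Fin n) ℝ) (G : Cube n → Set ℝ) : Prop :=
  ∀ J : Cube n,
    G J ⊆ taylorForm (gradProd f) (Sum.elim (fun i => J.mid i) (fun i => J.mid i)) J.width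

/-- The test with a direct interval approximation `G` of `⟨∂f, ∂f⟩` on `J × J`. -/
def prodTest {n : ℕ} (B G : Cube n → Set ℝ) (J : Cube n) : Prop :=
  (0 : ℝ) ∉ B J ∨ (0 : ℝ) ∉ G J

end

end PV

namespace PV

open MeasureTheory Set

/-! The proof is a continuous amortization. Suppose that every failing cube `K` satisfies `1 ≤ w(K)
L(x)` for all `x ∈ K`. A cube of the subdivision other than the root is a child of a failing cube
and has half its width, so `(2L)^n` has integral at least `1` over it. The cubes have disjoint
half-open cores inside the root, hence their number is at most `max 1 (∫ (2L)^n)` after every round.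
Rounds that do not stop add at least one cube each, so a run without end forces the integral to be
infinite (`numCubes_le`).

It is applied with `L = K κ_aff(f, ·)`. The integral over `[-a,a]^n` then equals `(2K)^n (2a)^n 𝔼
κ^n = (4K)^n a^n 𝔼 κ^n`, and the `1` in the maximum is absorbed because `κ ≥ 1/√(1+d)` everywhere
(`numCubes_le_meanKappaPow`). What remains is to show `1/κ(x) ≤ K w(J)` for each point `x` of a
failing cube `J`.

With `s = √(1+‖x‖²)`, Euler's identity for the homogenization bounds `‖f‖/κ(x)` by `√d (|f(x)| + s
‖∂f(x)‖/d) / s^(d-1)` (`sqrt_eval_tangent_le`). If the test fails, `f` is small because `0` lies in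
its enclosure, and `∂f` is small because two orthogonal vectors cannot both be close to a long one.
For the linearized maps both sizes are hypotheses, and `K = 4√2 d n`.

For centered forms the radii have to be compared with `‖f‖`. A radius is at most the sum of the
`|f_β|` times differences of monomials at two nearby points. Cauchy–Schwarz for the Weyl norm and
the multinomial theorem turn this into a Lipschitz estimate (`sum_abs_coeff_mul_sub_le`,
`taylorRadius_le_weylNorm`), which gives `K = d² 8^n`. -/

/-! ### Counting cubes by continuous amortization -/

/-- The half-open version of a cube. -/
def Cube.core {n : ℕ} (J : Cube n) : Set (EuclideanSpace ℝ (Fin n)) :=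
  {x | ∀ i, x i ∈ Ico (J.mid i - J.width / 2) (J.mid i + J.width / 2)}

theorem Cube.core_subset_toSet {n : ℕ} (J : Cube n) : J.core ⊆ J.toSet := by
  intro x hx i
  have := hx i
  rw [mem_Ico] at this
  rw [abs_le]
  constructor <;> linarith [this.1, this.2]

theorem Cube.core_eq_preimage {n : ℕ} (J : Cube n) :
    J.core = WithLp.ofLp ⁻¹'
      (univ.pi fun i => Ico (J.mid i - J.width / 2) (J.mid i + J.width / 2)) := by
  ext x
  simp [Cube.core]

theorem Cube.measurableSet_core {n : ℕ} (J : Cube n) : MeasurableSet J.core := by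
  rw [J.core_eq_preimage]
  exact (PiLp.volume_preserving_ofLp (Fin n)).measurable
    (MeasurableSet.univ_pi fun _ => measurableSet_Ico)

theorem Cube.volume_core {n : ℕ} (J : Cube n) :
    volume J.core = ENNReal.ofReal J.width ^ n := by
  rw [J.core_eq_preimage, (PiLp.volume_preserving_ofLp (Fin n)).measure_preimage
    (MeasurableSet.univ_pi fun _ => measurableSet_Ico).nullMeasurableSet, Real.volume_pi_Ico]
  have : ∀ i : Fin n, J.mid i + J.width / 2 - (J.mid i - J.width / 2) = J.width := by
    intro i; ring
  simp [this]

theorem Cube.mid_mem_core {n : ℕ} (J : Cube n) : J.mid ∈ J.core := by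
  intro i
  have := J.width_pos
  constructor <;> linarith

theorem Cube.core_child_subset {n : ℕ} (J : Cube n) (ε : Fin n → Bool) :
    (J.child ε).core ⊆ J.core := by
  intro x hx i
  have h := hx i
  have hw := J.width_pos
  simp only [Cube.child, mem_Ico] at h ⊢
  split_ifs at h <;> constructor <;> linarith [h.1, h.2]

theorem Cube.disjoint_core_child {n : ℕ} (J : Cube n) {ε ε' : Fin n → Bool} (h : ε ≠ ε') :
    Disjoint (J.child ε).core (J.child ε').core := by
  obtain ⟨i, hi⟩ := Function.ne_iff.1 h
  rw [Set.disjoint_left]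
  intro x hx hx'
  have h1 := hx i
  have h2 := hx' i
  have hw := J.width_pos
  simp only [Cube.child, mem_Ico] at h1 h2
  cases h3 : ε i <;> cases h4 : ε' i <;> simp_all <;> linarith [h1.1, h1.2, h2.1, h2.2]

variable {n : ℕ} {test : Cube n → Prop} {Q : Cube n}

theorem finite_subdivision (test : Cube n → Prop) (Q : Cube n) (k : ℕ) :
    (subdivision test Q k).Finite := by
  induction k with
  | zero => exact finite_singleton Q
  | succ k ih =>
    refine (ih.subset fun J hJ => hJ.1).union ?_
    refine (ih.biUnion fun K _ => finite_range K.child).subset ?_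
    rintro J ⟨K, hK, -, ε, rfl⟩
    exact mem_biUnion hK (mem_range_self ε)

theorem core_subset_of_mem_subdivision (k : ℕ) :
    ∀ J ∈ subdivision test Q k, J.core ⊆ Q.core := by
  induction k with
  | zero => rintro J rfl; exact subset_rfl
  | succ k ih =>
    rintro J (⟨hJ, -⟩ | ⟨K, hK, -, ε, rfl⟩)
    · exact ih J hJ
    · exact (K.core_child_subset ε).trans (ih K hK)

theorem eq_or_child_of_mem_subdivision (k : ℕ) :
    ∀ J ∈ subdivision test Q k, J = Q ∨ ∃ K, ¬ test K ∧ ∃ ε, J = K.child ε := by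
  induction k with
  | zero => rintro J rfl; exact Or.inl rfl
  | succ k ih =>
    rintro J (⟨hJ, -⟩ | ⟨K, hK, hK', ε, rfl⟩)
    · exact ih J hJ
    · exact Or.inr ⟨K, hK', ε, rfl⟩

theorem pairwiseDisjoint_subdivision (test : Cube n → Prop) (Q : Cube n) (k : ℕ) :
    (subdivision test Q k).PairwiseDisjoint Cube.core := by
  induction k with
  | zero => exact pairwiseDisjoint_singleton _ _
  | succ k ih =>
    rintro J (⟨hJ, hJt⟩ | ⟨K, hK, hKt, ε, rfl⟩) J' (⟨hJ', hJt'⟩ | ⟨K', hK', hKt', ε', rfl⟩) hne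
    · exact ih hJ hJ' hne
    · exact (ih hJ hK' (by rintro rfl; exact hKt' hJt)).mono_right (K'.core_child_subset ε')
    · exact (ih hK hJ' (by rintro rfl; exact hKt hJt')).mono_left (K.core_child_subset ε)
    · by_cases h : K = K'
      · subst h
        exact K.disjoint_core_child (by rintro rfl; exact hne rfl)
      · exact (ih hK hK' h).mono (K.core_child_subset ε) (K'.core_child_subset ε')

theorem Cube.not_disjoint_core_of_subset {J K : Cube n} (h : J.core ⊆ K.core) :
    ¬ Disjoint J.core K.core := fun hd =>
  Set.disjoint_left.1 hd J.mid_mem_core (h J.mid_mem_core)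

/-- A round in which some cube fails the test increases the number of cubes. -/
theorem encard_subdivision_succ (hn : 1 ≤ n) {k : ℕ} (h : ¬ StoppedAt test Q k) :
    (subdivision test Q k).encard + 1 ≤ (subdivision test Q (k + 1)).encard := by
  classical
  simp only [StoppedAt, not_forall] at h
  obtain ⟨K, hK, hKt⟩ := h
  have hd := pairwiseDisjoint_subdivision test Q k
  let φ : Cube n → Cube n := fun J => if test J then J else J.child fun _ => true
  have hφ : ∀ J, (φ J).core ⊆ J.core := by
    intro J
    by_cases hJ : test J
    · simp [φ, hJ]
    · simp only [φ, hJ, if_false]; exact J.core_child_subset _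
  -- A core contains its midpoint and cores of distinct cubes are disjoint, so a cube lying in the
  -- core of `J` determines `J`.
  have hinj : InjOn φ (subdivision test Q k) := by
    intro J hJ J' hJ' he
    by_contra hne
    exact Set.disjoint_left.1 (hd hJ hJ' hne) (hφ J (φ J).mid_mem_core)
      (hφ J' (he ▸ (φ J).mid_mem_core))
  have hnot : K.child (fun _ => false) ∉ φ '' subdivision test Q k := by
    rintro ⟨J, hJ, he⟩
    by_cases hJK : J = K
    · subst hJK
      simp only [φ, hKt, if_false] at he
      have := J.disjoint_core_child (ε := fun _ => true) (ε' := fun _ => false)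
        -- The two constant sign vectors differ only because `n ≥ 1`; a `0`-cube has a single child.
        (fun h => by simpa using congrFun h ⟨0, hn⟩)
      rw [he] at this
      exact Cube.not_disjoint_core_of_subset subset_rfl this
    · have h1 := hφ J (φ J).mid_mem_core
      rw [he] at h1
      exact Set.disjoint_left.1 (hd hJ hK hJK) h1
        (K.core_child_subset _ (K.child fun _ => false).mid_mem_core)
  rw [← hinj.encard_image, ← encard_insert_of_notMem hnot]
  refine encard_le_encard (insert_subset (Or.inr ⟨K, hK, hKt, _, rfl⟩) ?_)
  rintro _ ⟨J, hJ, rfl⟩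
  by_cases hJt : test J
  · simp only [φ, hJt, if_true]
    exact Or.inl ⟨hJ, hJt⟩
  · simp only [φ, hJt, if_false]
    exact Or.inr ⟨J, hJ, hJt, _, rfl⟩

theorem one_le_lintegral_core_child {K : Cube n} {L : EuclideanSpace ℝ (Fin n) → ℝ≥0∞}
    (h : ∀ x ∈ K.toSet, 1 ≤ ENNReal.ofReal K.width * L x) (ε : Fin n → Bool) :
    1 ≤ ∫⁻ x in (K.child ε).core, (2 * L x) ^ n := by
  set J := K.child ε with hJ
  have hw : ENNReal.ofReal K.width = ENNReal.ofReal J.width * 2 := by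
    have : K.width = J.width * 2 := by simp [hJ, Cube.child]
    rw [this, ENNReal.ofReal_mul J.width_pos.le]; simp
  have h0 : ENNReal.ofReal J.width ^ n ≠ 0 :=
    pow_ne_zero _ (by simpa using J.width_pos)
  have ht : ENNReal.ofReal J.width ^ n ≠ ⊤ := by finiteness
  -- After multiplication by `w(J)^n`, the volume of the core, the integrand becomes `(w(K) L(x))^n
  -- ≥ 1`.
  rw [← ENNReal.mul_le_mul_iff_right h0 ht, mul_one, ← lintegral_const_mul' _ _ ht]
  calc ENNReal.ofReal J.width ^ n = ∫⁻ _ in J.core, 1 := by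
        rw [setLIntegral_one, J.volume_core]
    _ ≤ _ := by
        refine setLIntegral_mono' J.measurableSet_core fun x hx => ?_
        rw [← mul_pow, ← mul_assoc, ← hw]
        exact one_le_pow₀ (h x (K.core_subset_toSet (K.core_child_subset ε hx)))

/-- If the local size of the failing cubes is controlled by `L`, so is the number of cubes. -/
theorem encard_subdivision_le {L : EuclideanSpace ℝ (Fin n) → ℝ≥0∞}
    (h : ∀ J, ¬ test J → ∀ x ∈ J.toSet, 1 ≤ ENNReal.ofReal J.width * L x) (k : ℕ) :
    ((subdivision test Q k).encard : ℝ≥0∞) ≤ max 1 (∫⁻ x in Q.toSet, (2 * L x) ^ n) := by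
  have hd := pairwiseDisjoint_subdivision test Q k
  -- The root has no failing parent to charge. As long as it is present it is the only cube, which
  -- accounts for the `1` in the maximum.
  by_cases hQ : Q ∈ subdivision test Q k
  · have : subdivision test Q k ⊆ {Q} := by
      intro J hJ
      by_contra hne
      exact Cube.not_disjoint_core_of_subset (core_subset_of_mem_subdivision k J hJ)
        (hd hJ hQ hne)
    refine le_max_of_le_left ?_
    exact_mod_cast (encard_le_encard this).trans (encard_singleton Q).le
  · refine le_max_of_le_right ?_
    have hfin := finite_subdivision test Q k
    set S := hfin.toFinset with hS
    have hmem : ∀ J, J ∈ S ↔ J ∈ subdivision test Q k := fun J => hfin.mem_toFinset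
    have hcard : ((subdivision test Q k).encard : ℝ≥0∞) = ∑ _J ∈ S, 1 := by
      rw [hfin.encard_eq_coe_toFinset_card]; simp [hS]
    rw [hcard]
    calc ∑ _J ∈ S, (1 : ℝ≥0∞) ≤ ∑ J ∈ S, ∫⁻ x in J.core, (2 * L x) ^ n := by
          refine Finset.sum_le_sum fun J hJ => ?_
          rw [hmem] at hJ
          rcases eq_or_child_of_mem_subdivision k J hJ with rfl | ⟨K, hK, ε, rfl⟩
          · exact absurd hJ hQ
          · exact one_le_lintegral_core_child (h K hK) ε
      _ = ∫⁻ x in ⋃ J ∈ S, J.core, (2 * L x) ^ n := by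
          rw [lintegral_biUnion_finset (by rwa [hfin.coe_toFinset])
            fun J _ => J.measurableSet_core]
      _ ≤ _ := lintegral_mono_set (iUnion₂_subset fun J hJ =>
          (core_subset_of_mem_subdivision k J ((hmem J).1 hJ)).trans Q.core_subset_toSet)

theorem numCubes_le (hn : 1 ≤ n) {L : EuclideanSpace ℝ (Fin n) → ℝ≥0∞}
    (h : ∀ J, ¬ test J → ∀ x ∈ J.toSet, 1 ≤ ENNReal.ofReal J.width * L x) :
    (numCubes test Q : ℝ≥0∞) ≤ max 1 (∫⁻ x in Q.toSet, (2 * L x) ^ n) := by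
  classical
  by_cases hs : ∃ k, StoppedAt test Q k
  · rw [numCubes, dif_pos hs]
    exact encard_subdivision_le h _
  · push Not at hs
    have hgrow : ∀ k : ℕ, (k : ℕ∞) ≤ (subdivision test Q k).encard := by
      intro k
      induction k with
      | zero => simp
      | succ k ih =>
        push_cast
        exact (add_le_add_left ih 1).trans (encard_subdivision_succ hn (hs k))
    -- The amortized bound holds after every round, not only after the last one, so unbounded counts
    -- make it infinite.
    have htop : max 1 (∫⁻ x in Q.toSet, (2 * L x) ^ n) = ⊤ := by
      refine ENNReal.eq_top_of_forall_nnreal_le fun r => ?_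
      obtain ⟨k, hk⟩ := exists_nat_ge r
      refine le_trans ?_ (encard_subdivision_le h k)
      calc (r : ℝ≥0∞) ≤ (k : ℝ≥0∞) := by exact_mod_cast hk
        _ = (((k : ℕ) : ℕ∞) : ℝ≥0∞) := by simp
        _ ≤ _ := by exact_mod_cast hgrow k
    rw [htop]
    exact le_top

end PV

namespace PV

open MvPolynomial

/-! ### Inequalities for the Weyl norm -/

theorem degree_eq_of_isHomogeneous {m d : ℕ} {F : MvPolynomial (Fin m) ℝ} (hF : F.IsHomogeneous d)
    {γ : Fin m →₀ ℕ} (hγ : γ ∈ F.support) : ∑ i, γ i = d := by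
  have := hF (mem_support_iff.1 hγ)
  rw [← this, Finsupp.weight_apply, Finsupp.sum_fintype _ _ (by simp)]
  simp

theorem finsupp_multinomial_eq {m : ℕ} (γ : Fin m →₀ ℕ) :
    γ.multinomial = Nat.multinomial Finset.univ γ :=
  Finsupp.multinomial_eq_of_support_subset (Finset.subset_univ _)

theorem multinomial_pos {m : ℕ} (γ : Fin m →₀ ℕ) : (0 : ℝ) < γ.multinomial := by
  rw [finsupp_multinomial_eq]
  exact_mod_cast Nat.multinomial_pos _ _

theorem sq_weylNorm {m : ℕ} (F : MvPolynomial (Fin m) ℝ) :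
    weylNorm F ^ 2 = ∑ γ ∈ F.support, F.coeff γ ^ 2 / (γ.multinomial : ℝ) :=
  Real.sq_sqrt (Finset.sum_nonneg fun γ _ => div_nonneg (sq_nonneg _) (multinomial_pos γ).le)

theorem weylNorm_nonneg {m : ℕ} (F : MvPolynomial (Fin m) ℝ) : 0 ≤ weylNorm F := Real.sqrt_nonneg _

theorem weylNorm_pos {m : ℕ} {F : MvPolynomial (Fin m) ℝ} (hF : F ≠ 0) : 0 < weylNorm F := by
  refine Real.sqrt_pos.2 (Finset.sum_pos (fun γ hγ => ?_) (by simpa using hF))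
  exact div_pos (by positivity [mem_support_iff.1 hγ]) (multinomial_pos γ)

/-- The Cauchy–Schwarz inequality for the Weyl inner product. -/
theorem sum_abs_coeff_mul_le {m : ℕ} (F : MvPolynomial (Fin m) ℝ) (φ : (Fin m →₀ ℕ) → ℝ) :
    ∑ γ ∈ F.support, |F.coeff γ| * |φ γ| ≤
      weylNorm F * √(∑ γ ∈ F.support, γ.multinomial * φ γ ^ 2) := by
  have h := Real.sum_mul_le_sqrt_mul_sqrt F.support
    (fun γ => |F.coeff γ| / √(γ.multinomial : ℝ)) (fun γ => √(γ.multinomial : ℝ) * |φ γ|)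
  have h1 : ∀ γ : Fin m →₀ ℕ, √(γ.multinomial : ℝ) ≠ 0 := fun γ =>
    (Real.sqrt_pos.2 (multinomial_pos γ)).ne'
  convert h using 1
  · refine Finset.sum_congr rfl fun γ _ => ?_
    field_simp [h1 γ]
  · rw [weylNorm]
    congr 2
    · refine Finset.sum_congr rfl fun γ _ => ?_
      rw [div_pow, sq_abs, Real.sq_sqrt (multinomial_pos γ).le]
    · refine Finset.sum_congr rfl fun γ _ => ?_
      rw [mul_pow, sq_abs, Real.sq_sqrt (multinomial_pos γ).le]

/-- Passes from the support of `F` to all exponents of degree `d`, where the multinomial theorem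
evaluates the sum. -/
theorem sum_multinomial_mul_sq_le {m d : ℕ} {F : MvPolynomial (Fin m) ℝ} (hF : F.IsHomogeneous d)
    (φ : (Fin m → ℕ) → ℝ) :
    ∑ γ ∈ F.support, (γ.multinomial : ℝ) * φ γ ^ 2 ≤
      ∑ k ∈ Finset.piAntidiag Finset.univ d, (Nat.multinomial Finset.univ k : ℝ) * φ k ^ 2 := by
  classical
  have : ∑ γ ∈ F.support, (γ.multinomial : ℝ) * φ γ ^ 2 =
      ∑ k ∈ F.support.image (fun γ : Fin m →₀ ℕ => (γ : Fin m → ℕ)),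
        (Nat.multinomial Finset.univ k : ℝ) * φ k ^ 2 := by
    rw [Finset.sum_image (fun _ _ _ _ h => DFunLike.coe_injective h)]
    exact Finset.sum_congr rfl fun γ _ => by rw [finsupp_multinomial_eq]
  rw [this]
  refine Finset.sum_le_sum_of_subset_of_nonneg ?_ fun k _ _ => by positivity
  intro k hk
  obtain ⟨γ, hγ, rfl⟩ := Finset.mem_image.1 hk
  simp [degree_eq_of_isHomogeneous hF hγ]

theorem sum_mul_pow_eq {m : ℕ} (u z : Fin m → ℝ) (d : ℕ) :
    (∑ i, u i * z i) ^ d = ∑ k ∈ Finset.piAntidiag Finset.univ d,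
      (Nat.multinomial Finset.univ k : ℝ) * ((∏ i, u i ^ k i) * ∏ i, z i ^ k i) := by
  rw [Finset.sum_pow_eq_sum_piAntidiag]
  refine Finset.sum_congr rfl fun k _ => ?_
  rw [← Finset.prod_mul_distrib]
  simp_rw [mul_pow]

/-- Cauchy–Schwarz against the monomials at `z`, whose weighted square sum is `⟨z,z⟩^d`. -/
theorem abs_eval_le_weylNorm_mul {m d : ℕ} {F : MvPolynomial (Fin m) ℝ} (hF : F.IsHomogeneous d)
    (z : Fin m → ℝ) : |eval z F| ≤ weylNorm F * √(∑ i, z i ^ 2) ^ d := by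
  calc |eval z F| ≤ ∑ γ ∈ F.support, |F.coeff γ| * |∏ i, z i ^ γ i| := by
        rw [eval_eq']
        refine (Finset.abs_sum_le_sum_abs _ _).trans (le_of_eq ?_)
        exact Finset.sum_congr rfl fun γ _ => abs_mul _ _
    _ ≤ weylNorm F * √(∑ γ ∈ F.support, γ.multinomial * (∏ i, z i ^ γ i) ^ 2) :=
        sum_abs_coeff_mul_le F fun γ => ∏ i, z i ^ γ i
    _ ≤ weylNorm F * √(∑ i, z i ^ 2) ^ d := by
        refine mul_le_mul_of_nonneg_left ?_ (weylNorm_nonneg F)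
        rw [Real.sqrt_le_left (by positivity), ← pow_mul, mul_comm d, pow_mul,
          Real.sq_sqrt (by positivity)]
        refine (sum_multinomial_mul_sq_le hF fun k => ∏ i, z i ^ k i).trans (le_of_eq ?_)
        simp_rw [pow_two]
        rw [sum_mul_pow_eq]

/-- With `A = ‖u‖`, `B = ‖z‖`, `p = ⟨u,z⟩` this compares the kernels `⟨·,·⟩^d` and `⟨·,·⟩`. The left
side is `(A^d - B^d)² + 2((AB)^d - p^d)`, and each part is bounded by the mean value estimate for `t
↦ t^d`. -/
theorem pow_two_mul_sub_le {A B M p : ℝ} (d : ℕ) (hA : 0 ≤ A) (hB : 0 ≤ B) (hAM : A ≤ M)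
    (hBM : B ≤ M) (hp : |p| ≤ A * B) :
    (A ^ 2) ^ d - 2 * p ^ d + (B ^ 2) ^ d ≤ (d * M ^ (d - 1)) ^ 2 * (A ^ 2 - 2 * p + B ^ 2) := by
  have hM : 0 ≤ M := hA.trans hAM
  have h1 : |A ^ d - B ^ d| ≤ |A - B| * (d * M ^ (d - 1)) := by
    refine (abs_pow_sub_pow_le A B d).trans ?_
    rw [mul_assoc, abs_of_nonneg hA, abs_of_nonneg hB]
    gcongr
    exact max_le hAM hBM
  have h2 : (A * B) ^ d - p ^ d ≤ (A * B - p) * (d * M ^ (d - 1)) ^ 2 := by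
    have hAB : p ≤ A * B := (le_abs_self p).trans hp
    refine (le_abs_self _).trans ((abs_pow_sub_pow_le (A * B) p d).trans ?_)
    rw [mul_assoc, abs_of_nonneg (sub_nonneg.2 hAB), abs_of_nonneg (mul_nonneg hA hB),
      max_eq_left hp]
    refine mul_le_mul_of_nonneg_left ?_ (sub_nonneg.2 hAB)
    rw [mul_pow (d : ℝ), ← pow_mul, mul_comm (d - 1), pow_mul]
    refine mul_le_mul ?_ ?_ (by positivity) (by positivity)
    -- The mean value estimate yields only one factor `d` here; it is weakened to `d²` to match the
    -- other part.
    · have : d ≤ d ^ 2 := Nat.le_self_pow two_ne_zero d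
      exact_mod_cast this
    · refine pow_le_pow_left₀ (mul_nonneg hA hB) ?_ _
      rw [pow_two]
      exact mul_le_mul hAM hBM hB hM
  have h3 := sq_le_sq' (neg_le_of_abs_le h1) (le_of_abs_le h1)
  rw [mul_pow, sq_abs] at h3
  rw [mul_pow] at h2
  rw [pow_right_comm A, pow_right_comm B]
  nlinarith

/-- A Lipschitz bound in terms of the Weyl norm that holds monomial by monomial. -/
theorem sum_abs_coeff_mul_sub_le {m d : ℕ} {F : MvPolynomial (Fin m) ℝ} (hF : F.IsHomogeneous d)
    (u z : Fin m → ℝ) {M : ℝ} (hu : √(∑ i, u i ^ 2) ≤ M) (hz : √(∑ i, z i ^ 2) ≤ M) :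
    ∑ γ ∈ F.support, |F.coeff γ| * |∏ i, u i ^ γ i - ∏ i, z i ^ γ i| ≤
      weylNorm F * (d * M ^ (d - 1) * √(∑ i, (u i - z i) ^ 2)) := by
  have hM : 0 ≤ M := (Real.sqrt_nonneg _).trans hu
  refine (sum_abs_coeff_mul_le F fun γ => ∏ i, u i ^ γ i - ∏ i, z i ^ γ i).trans ?_
  refine mul_le_mul_of_nonneg_left ?_ (weylNorm_nonneg F)
  rw [Real.sqrt_le_left (by positivity), mul_pow, Real.sq_sqrt (by positivity)]
  refine (sum_multinomial_mul_sq_le hF fun k => ∏ i, u i ^ k i - ∏ i, z i ^ k i).trans ?_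
  have hK := pow_two_mul_sub_le (p := ∑ i, u i * z i) d (Real.sqrt_nonneg (∑ i, u i ^ 2))
    (Real.sqrt_nonneg (∑ i, z i ^ 2)) hu hz (by
      rw [abs_le]
      refine ⟨?_, Real.sum_mul_le_sqrt_mul_sqrt _ u z⟩
      have := Real.sum_mul_le_sqrt_mul_sqrt Finset.univ (fun i => -u i) z
      simp only [neg_mul, Finset.sum_neg_distrib, neg_sq] at this
      linarith)
  rw [Real.sq_sqrt (by positivity), Real.sq_sqrt (by positivity)] at hK
  refine (le_of_eq ?_).trans (hK.trans (le_of_eq ?_))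
  -- Squaring out `(u^γ - z^γ)²`, the weighted sum is `⟨u,u⟩^d - 2⟨u,z⟩^d + ⟨z,z⟩^d`.
  · have hsq : ∀ v : Fin m → ℝ, ∑ i, v i ^ 2 = ∑ i, v i * v i := fun v => by simp_rw [pow_two]
    rw [hsq u, hsq z, sum_mul_pow_eq, sum_mul_pow_eq, sum_mul_pow_eq, Finset.mul_sum,
      ← Finset.sum_sub_distrib, ← Finset.sum_add_distrib]
    exact Finset.sum_congr rfl fun k _ => by ring
  · congr 1
    rw [Finset.mul_sum, ← Finset.sum_sub_distrib, ← Finset.sum_add_distrib]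
    exact Finset.sum_congr rfl fun i _ => by ring

/-! ### Weyl norms of partial derivatives. -/

theorem multinomial_add_single {m : ℕ} (β : Fin m →₀ ℕ) (i : Fin m) :
    (β + Finsupp.single i 1 : Fin m →₀ ℕ).multinomial * (β i + 1) = (∑ j, β j + 1) * β.multinomial := by
  classical
  rw [finsupp_multinomial_eq, finsupp_multinomial_eq]
  have h1 := Nat.multinomial_spec Finset.univ β
  have h2 := Nat.multinomial_spec Finset.univ ⇑(β + Finsupp.single i 1 : Fin m →₀ ℕ)
  have h3 : ∑ j, (β + Finsupp.single i 1 : Fin m →₀ ℕ) j = ∑ j, β j + 1 := by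
    simp [Finset.sum_add_distrib, Finsupp.single_apply]
  have h4 : ∏ j, Nat.factorial ((β + Finsupp.single i 1 : Fin m →₀ ℕ) j) =
      (β i + 1) * ∏ j, Nat.factorial (β j) := by
    rw [← Finset.mul_prod_erase _ _ (Finset.mem_univ i),
      ← Finset.mul_prod_erase _ (fun j => Nat.factorial (β j)) (Finset.mem_univ i), ← mul_assoc]
    congr 1
    · simp [Nat.factorial_succ]
    · refine Finset.prod_congr rfl fun j hj => ?_
      simp [(Finset.ne_of_mem_erase hj).symm]
  rw [h3, h4, Nat.factorial_succ, ← h1] at h2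
  have h5 : 0 < ∏ j, Nat.factorial (β j) := Finset.prod_pos fun j _ => Nat.factorial_pos _
  refine Nat.eq_of_mul_eq_mul_left h5 ?_
  linarith

/-- The factor `β_i + 1` produced by differentiation is partly cancelled by the ratio `d/(β_i + 1)`
of the multinomials, leaving the weight `d γ_i`. Summing over `i` then gives `d²`, since `∑ γ_i =
d`. -/
theorem sq_weylNorm_pderiv_le {m d : ℕ} {F : MvPolynomial (Fin m) ℝ} (hF : F.IsHomogeneous d)
    (i : Fin m) : weylNorm (pderiv i F) ^ 2 ≤
      ∑ γ ∈ F.support, d * γ i * (F.coeff γ ^ 2 / (γ.multinomial : ℝ)) := by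
  classical
  rw [sq_weylNorm]
  have hmem : ∀ β ∈ (pderiv i F).support, β + Finsupp.single i 1 ∈ F.support := by
    intro β hβ
    rw [mem_support_iff, coeff_pderiv] at hβ
    exact mem_support_iff.2 fun h => hβ (by simp [h])
  have hterm : ∀ β ∈ (pderiv i F).support,
      (pderiv i F).coeff β ^ 2 / (β.multinomial : ℝ) =
        d * (β + Finsupp.single i 1 : Fin m →₀ ℕ) i * (F.coeff (β + Finsupp.single i 1) ^ 2 /
          ((β + Finsupp.single i 1).multinomial : ℝ)) := by
    intro β hβ
    have hd := degree_eq_of_isHomogeneous hF (hmem β hβ)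
    simp only [Finsupp.add_apply, Finset.sum_add_distrib, Finsupp.single_apply,
      Finset.sum_ite_eq, Finset.mem_univ, if_true] at hd
    have h := multinomial_add_single β i
    rw [hd] at h
    have h' : ((β + Finsupp.single i 1).multinomial : ℝ) * (β i + 1) = d * β.multinomial := by
      exact_mod_cast h
    have p1 := multinomial_pos β
    have p2 := multinomial_pos (β + Finsupp.single i 1)
    rw [coeff_pderiv]
    simp only [Finsupp.add_apply, Finsupp.single_eq_same, Nat.cast_add, Nat.cast_one]
    field_simp
    linear_combination (F.coeff (β + Finsupp.single i 1) ^ 2) * h'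
  rw [Finset.sum_congr rfl hterm]
  rw [← Finset.sum_image (f := fun γ : Fin m →₀ ℕ =>
    (d : ℝ) * γ i * (F.coeff γ ^ 2 / (γ.multinomial : ℝ)))
    (g := fun β => β + Finsupp.single i 1) (fun _ _ _ _ h => add_right_cancel h)]
  refine Finset.sum_le_sum_of_subset_of_nonneg (Finset.image_subset_iff.2 hmem) fun γ _ _ => ?_
  have := multinomial_pos γ
  positivity

theorem sum_sq_weylNorm_pderiv_le {m d : ℕ} {F : MvPolynomial (Fin m) ℝ}
    (hF : F.IsHomogeneous d) :
    ∑ i, weylNorm (pderiv i F) ^ 2 ≤ (d * weylNorm F) ^ 2 := by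
  refine (Finset.sum_le_sum fun i _ => sq_weylNorm_pderiv_le hF i).trans (le_of_eq ?_)
  rw [Finset.sum_comm, mul_pow, sq_weylNorm, Finset.mul_sum]
  refine Finset.sum_congr rfl fun γ hγ => ?_
  rw [← Finset.sum_mul, ← Finset.mul_sum]
  congr 1
  rw [pow_two]
  congr 1
  exact_mod_cast degree_eq_of_isHomogeneous hF hγ

/-! ### Homogenization -/

variable {n : ℕ}

theorem homogenize_eq_sum_of_subset (d : ℕ) {f : MvPolynomial (Fin n) ℝ}
    {S : Finset (Fin n →₀ ℕ)} (hS : f.support ⊆ S) :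
    homogenize d f = ∑ α ∈ S, monomial (Finsupp.cons (d - α.degree) α) (f.coeff α) :=
  Finset.sum_subset hS fun α _ hα => by simp [notMem_support_iff.1 hα]

theorem homogenize_add (d : ℕ) (f g : MvPolynomial (Fin n) ℝ) :
    homogenize d (f + g) = homogenize d f + homogenize d g := by
  classical
  rw [homogenize_eq_sum_of_subset d (support_add (p := f) (q := g)),
    homogenize_eq_sum_of_subset d (Finset.subset_union_left (s₁ := f.support) (s₂ := g.support)),
    homogenize_eq_sum_of_subset d (Finset.subset_union_right (s₁ := f.support) (s₂ := g.support)),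
    ← Finset.sum_add_distrib]
  simp

theorem homogenize_monomial (d : ℕ) (α : Fin n →₀ ℕ) (c : ℝ) :
    homogenize d (monomial α c) = monomial (Finsupp.cons (d - α.degree) α) c := by
  rw [homogenize_eq_sum_of_subset d support_monomial_subset]
  simp

theorem cons_sub_degree_injective (d : ℕ) :
    Function.Injective fun α : Fin n →₀ ℕ => Finsupp.cons (d - α.degree) α := fun _ _ h =>
  (Finsupp.cons_injective2 h).2

theorem coeff_homogenize_cons (d : ℕ) (f : MvPolynomial (Fin n) ℝ) (α : Fin n →₀ ℕ) :
    (homogenize d f).coeff (Finsupp.cons (d - α.degree) α) = f.coeff α := by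
  classical
  simp only [homogenize, coeff_sum, coeff_monomial]
  simp_rw [(cons_sub_degree_injective d).eq_iff]
  simp [eq_comm]

theorem support_homogenize [DecidableEq (Fin (n + 1) →₀ ℕ)] (d : ℕ) (f : MvPolynomial (Fin n) ℝ) :
    (homogenize d f).support = f.support.image fun α => Finsupp.cons (d - α.degree) α := by
  ext γ
  constructor
  · intro hγ
    rw [mem_support_iff, homogenize, coeff_sum] at hγ
    obtain ⟨α, hα, hne⟩ := Finset.exists_ne_zero_of_sum_ne_zero hγ
    rw [coeff_monomial] at hne
    exact Finset.mem_image.2 ⟨α, hα, by by_contra h; simp [h] at hne⟩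
  · intro hγ
    obtain ⟨α, hα, rfl⟩ := Finset.mem_image.1 hγ
    rw [mem_support_iff, coeff_homogenize_cons]
    exact mem_support_iff.1 hα

theorem sum_support_homogenize (d : ℕ) (f : MvPolynomial (Fin n) ℝ)
    (φ : (Fin (n + 1) →₀ ℕ) → ℝ) :
    ∑ γ ∈ (homogenize d f).support, φ γ =
      ∑ α ∈ f.support, φ (Finsupp.cons (d - α.degree) α) := by
  classical
  rw [support_homogenize, Finset.sum_image fun _ _ _ _ h => cons_sub_degree_injective d h]

theorem homogenize_ne_zero (d : ℕ) {f : MvPolynomial (Fin n) ℝ} (hf : f ≠ 0) :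
    homogenize d f ≠ 0 := by
  obtain ⟨α, hα⟩ := ne_zero_iff.1 hf
  exact ne_zero_iff.2 ⟨_, (coeff_homogenize_cons d f α).trans_ne hα⟩

theorem isHomogeneous_homogenize {d : ℕ} {f : MvPolynomial (Fin n) ℝ} (hf : f.totalDegree ≤ d) :
    (homogenize d f).IsHomogeneous d := by
  refine IsHomogeneous.sum _ _ _ fun α hα => isHomogeneous_monomial _ ?_
  have h1 : α.degree ≤ d := by
    refine le_trans ?_ hf
    rw [Finsupp.degree_eq_sum]
    have := le_totalDegree hα
    rwa [Finsupp.sum_fintype _ _ (by simp)] at this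
  rw [Finsupp.degree_eq_sum, Fin.sum_univ_succ]
  simp only [Finsupp.cons_zero, Finsupp.cons_succ]
  rw [Finsupp.degree_eq_sum] at h1 ⊢
  omega

theorem prod_pow_cons (t : ℝ) (x : Fin n → ℝ) (k : ℕ) (α : Fin n →₀ ℕ) :
    ∏ i, (Fin.cons t x : Fin (n + 1) → ℝ) i ^ (Finsupp.cons k α) i = t ^ k * ∏ i, x i ^ α i := by
  rw [Fin.prod_univ_succ]
  simp

theorem eval_cons_one_homogenize (d : ℕ) (f : MvPolynomial (Fin n) ℝ) (x : Fin n → ℝ) :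
    eval (Fin.cons 1 x) (homogenize d f) = eval x f := by
  rw [eval_eq', eval_eq', sum_support_homogenize]
  refine Finset.sum_congr rfl fun α _ => ?_
  rw [coeff_homogenize_cons, prod_pow_cons]
  simp

/-- No degree bound is needed: for `α_i ≠ 0` the exponents `d - |α|` and `(d - 1) - (|α| - 1)` agree
even as truncated differences. -/
theorem pderiv_succ_homogenize (d : ℕ) (f : MvPolynomial (Fin n) ℝ) (i : Fin n) :
    pderiv i.succ (homogenize d f) = homogenize (d - 1) (pderiv i f) := by
  induction f using MvPolynomial.induction_on' with
  | add p q hp hq => rw [homogenize_add, map_add, map_add, homogenize_add, hp, hq]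
  | monomial α c =>
    rw [homogenize_monomial, pderiv_monomial, pderiv_monomial, homogenize_monomial]
    by_cases h : α i = 0
    · simp [h]
    · rw [Finsupp.cons_succ]
      have hdeg : (α - Finsupp.single i 1).degree + 1 = α.degree := by
        have h1 : α - Finsupp.single i 1 + Finsupp.single i 1 = α :=
          tsub_add_cancel_of_le (Finsupp.single_le_iff.2 (Nat.one_le_iff_ne_zero.2 h))
        conv_rhs => rw [← h1]
        simp
      refine congrArg (fun γ => monomial γ (c * (α i : ℝ))) (Finsupp.ext fun j => ?_)
      refine Fin.cases ?_ (fun j => ?_) j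
      · simp
        omega
      · simp [Finsupp.single_apply, Fin.succ_inj]

end PV

namespace PV

open MvPolynomial

/-! ### The condition number -/

theorem hasFDerivAt_evalAt {m : ℕ} (F : MvPolynomial (Fin m) ℝ) (y : EuclideanSpace ℝ (Fin m)) :
    HasFDerivAt (evalAt F)
      (∑ i, evalAt (pderiv i F) y • (EuclideanSpace.proj i : EuclideanSpace ℝ (Fin m) →L[ℝ] ℝ))
      y := by
  classical
  induction F using MvPolynomial.induction_on with
  | C a =>
    have h : evalAt (C a : MvPolynomial (Fin m) ℝ) = fun _ => a := by ext; simp [evalAt]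
    rw [h]
    refine (hasFDerivAt_const a y).congr_fderiv ?_
    simp [evalAt]
  | add p q hp hq =>
    have h : evalAt (p + q) = evalAt p + evalAt q := by ext; simp [evalAt]
    rw [h]
    refine (hp.add hq).congr_fderiv ?_
    rw [← Finset.sum_add_distrib]
    exact Finset.sum_congr rfl fun i _ => by simp [evalAt, add_smul]
  | mul_X p j hp =>
    have h : evalAt (p * X j) = fun z => evalAt p z * z j := by ext; simp [evalAt]
    rw [h]
    have hj : HasFDerivAt (fun z : EuclideanSpace ℝ (Fin m) => z j)
        (EuclideanSpace.proj j : EuclideanSpace ℝ (Fin m) →L[ℝ] ℝ) y :=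
      (EuclideanSpace.proj j : EuclideanSpace ℝ (Fin m) →L[ℝ] ℝ).hasFDerivAt
    refine (hp.mul hj).congr_fderiv ?_
    have hX : ∀ i, evalAt (pderiv i (p * X j)) y =
        y j * evalAt (pderiv i p) y + if i = j then evalAt p y else 0 := fun i => by
      rw [pderiv_mul, pderiv_X]
      by_cases hij : i = j
      · subst hij; simp [evalAt, mul_comm]
      · simp [evalAt, hij, Ne.symm hij, mul_comm]
    simp_rw [hX, add_smul, Finset.sum_add_distrib, Finset.smul_sum, smul_smul]
    rw [add_comm]
    simp

theorem fderiv_evalAt_apply {m : ℕ} (F : MvPolynomial (Fin m) ℝ)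
    (y v : EuclideanSpace ℝ (Fin m)) :
    fderiv ℝ (evalAt F) y v = ∑ i, v i * evalAt (pderiv i F) y := by
  rw [(hasFDerivAt_evalAt F y).fderiv]
  simp [mul_comm]

theorem eval_mul_of_isHomogeneous {m d : ℕ} {F : MvPolynomial (Fin m) ℝ}
    (hF : F.IsHomogeneous d) (t : ℝ) (z : Fin m → ℝ) :
    eval (fun i => t * z i) F = t ^ d * eval z F := by
  rw [eval_eq', eval_eq', Finset.mul_sum]
  refine Finset.sum_congr rfl fun γ hγ => ?_
  simp_rw [mul_pow]
  rw [Finset.prod_mul_distrib, Finset.prod_pow_eq_pow_sum, degree_eq_of_isHomogeneous hF hγ]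
  ring

/-! ### Values and tangent derivatives of the homogenization in affine coordinates. -/

variable {n d : ℕ}

theorem sphereMap_apply_zero (x : EuclideanSpace ℝ (Fin n)) :
    sphereMap x 0 = (√(1 + ‖x‖ ^ 2))⁻¹ := by
  simp [sphereMap]

theorem sphereMap_apply_succ (x : EuclideanSpace ℝ (Fin n)) (i : Fin n) :
    sphereMap x i.succ = (√(1 + ‖x‖ ^ 2))⁻¹ * x i := by
  simp [sphereMap]

theorem sum_sq_cons_one (x : EuclideanSpace ℝ (Fin n)) :
    ∑ i, (Fin.cons 1 (fun i => x i) : Fin (n + 1) → ℝ) i ^ 2 = 1 + ‖x‖ ^ 2 := by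
  rw [Fin.sum_univ_succ, EuclideanSpace.real_norm_sq_eq]
  simp

theorem norm_sphereMap (x : EuclideanSpace ℝ (Fin n)) : ‖sphereMap x‖ = 1 := by
  have h : 0 < 1 + ‖x‖ ^ 2 := by positivity
  have h1 : ‖(WithLp.toLp 2 (Fin.cons 1 fun i => x i) : EuclideanSpace ℝ (Fin (n + 1)))‖ =
      √(1 + ‖x‖ ^ 2) := by
    rw [EuclideanSpace.norm_eq, ← sum_sq_cons_one]
    simp
  rw [sphereMap, norm_smul, h1, norm_inv, Real.norm_of_nonneg (Real.sqrt_nonneg _)]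
  exact inv_mul_cancel₀ (Real.sqrt_pos.2 h).ne'

theorem evalAt_sphereMap {F : MvPolynomial (Fin (n + 1)) ℝ} (hF : F.IsHomogeneous d)
    (x : EuclideanSpace ℝ (Fin n)) :
    evalAt F (sphereMap x) = (√(1 + ‖x‖ ^ 2))⁻¹ ^ d * eval (Fin.cons 1 fun i => x i) F := by
  rw [← eval_mul_of_isHomogeneous hF]
  simp [evalAt, sphereMap]

theorem evalAt_homogenize_sphereMap {f : MvPolynomial (Fin n) ℝ} (hf : f.totalDegree ≤ d)
    (x : EuclideanSpace ℝ (Fin n)) :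
    evalAt (homogenize d f) (sphereMap x) = (√(1 + ‖x‖ ^ 2))⁻¹ ^ d * evalAt f x := by
  rw [evalAt_sphereMap (isHomogeneous_homogenize hf), eval_cons_one_homogenize, evalAt]

theorem evalAt_pderiv_homogenize_sphereMap {f : MvPolynomial (Fin n) ℝ}
    (hf : f.totalDegree ≤ d) (x : EuclideanSpace ℝ (Fin n)) (i : Fin n) :
    evalAt (pderiv i.succ (homogenize d f)) (sphereMap x) =
      (√(1 + ‖x‖ ^ 2))⁻¹ ^ (d - 1) * grad f x i := by
  rw [evalAt_sphereMap (isHomogeneous_homogenize hf).pderiv, pderiv_succ_homogenize,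
    eval_cons_one_homogenize]
  simp [grad, evalAt]

theorem tangentNorm_le {m : ℕ} {F : MvPolynomial (Fin m) ℝ} {y : EuclideanSpace ℝ (Fin m)}
    {C : ℝ} (hC : 0 ≤ C)
    (h : ∀ v : EuclideanSpace ℝ (Fin m), inner ℝ y v = 0 →
      |∑ i, v i * evalAt (pderiv i F) y| ≤ C * ‖v‖) : tangentNorm F y ≤ C := by
  refine ContinuousLinearMap.opNorm_le_bound _ hC fun v => ?_
  have hv := Submodule.mem_orthogonal_singleton_iff_inner_right.1 v.2
  have := h v hv
  rw [← fderiv_evalAt_apply] at this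
  simpa using this

theorem tangentNorm_nonneg {m : ℕ} (F : MvPolynomial (Fin m) ℝ) (y : EuclideanSpace ℝ (Fin m)) :
    0 ≤ tangentNorm F y := by
  unfold tangentNorm
  exact ContinuousLinearMap.opNorm_nonneg _

/-- The tangential derivative is bounded by the Weyl norm. -/
theorem tangentNorm_le_weylNorm {m : ℕ} {F : MvPolynomial (Fin m) ℝ} (hF : F.IsHomogeneous d)
    {y : EuclideanSpace ℝ (Fin m)} (hy : ‖y‖ = 1) : tangentNorm F y ≤ d * weylNorm F := by
  have hy' : √(∑ i, y i ^ 2) = 1 := by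
    rw [← EuclideanSpace.real_norm_sq_eq, hy]; simp
  refine tangentNorm_le (mul_nonneg (Nat.cast_nonneg d) (weylNorm_nonneg F)) fun v _ => ?_
  have hW := weylNorm_nonneg F
  have h1 : ∀ i, |evalAt (pderiv i F) y| ≤ weylNorm (pderiv i F) := fun i => by
    have := abs_eval_le_weylNorm_mul (hF.pderiv (i := i)) (fun i => y i)
    rwa [hy', one_pow, mul_one] at this
  calc |∑ i, v i * evalAt (pderiv i F) y| ≤ ∑ i, |v i| * |evalAt (pderiv i F) y| := by
        refine (Finset.abs_sum_le_sum_abs _ _).trans (le_of_eq ?_)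
        simp_rw [abs_mul]
    _ ≤ √(∑ i, |v i| ^ 2) * √(∑ i, |evalAt (pderiv i F) y| ^ 2) :=
        Real.sum_mul_le_sqrt_mul_sqrt _ _ _
    _ ≤ ‖v‖ * (d * weylNorm F) := by
        refine mul_le_mul (le_of_eq ?_) ?_ (Real.sqrt_nonneg _) (norm_nonneg _)
        · rw [EuclideanSpace.norm_eq]; rfl
        · rw [Real.sqrt_le_left (by positivity)]
          refine le_trans (Finset.sum_le_sum fun i _ => ?_) (sum_sq_weylNorm_pderiv_le hF)
          exact pow_le_pow_left₀ (abs_nonneg _) (h1 i) 2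
    _ = _ := mul_comm _ _

/-- This is `κ ≥ 1/√(1+d)`. It bounds the mean of `κ^n` from below and settles the case of large
cubes for centered forms. -/
theorem sqrt_eval_tangent_le_weylNorm {m : ℕ} {F : MvPolynomial (Fin m) ℝ} (hd : 1 ≤ d)
    (hF : F.IsHomogeneous d) {y : EuclideanSpace ℝ (Fin m)} (hy : ‖y‖ = 1) :
    √(evalAt F y ^ 2 + tangentNorm F y ^ 2 / d) ≤ √(1 + d) * weylNorm F := by
  have hy' : √(∑ i, y i ^ 2) = 1 := by
    rw [← EuclideanSpace.real_norm_sq_eq, hy]; simp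
  have hW := weylNorm_nonneg F
  have hd0 : (0 : ℝ) < d := by exact_mod_cast hd
  have h1 : |evalAt F y| ≤ weylNorm F := by
    have := abs_eval_le_weylNorm_mul hF (fun i => y i)
    rwa [hy', one_pow, mul_one] at this
  have h2 := tangentNorm_le_weylNorm hF hy
  have h3 : evalAt F y ^ 2 ≤ weylNorm F ^ 2 := by
    rw [← sq_abs]; exact pow_le_pow_left₀ (abs_nonneg _) h1 2
  have h4 : tangentNorm F y ^ 2 / d ≤ d * weylNorm F ^ 2 := by
    rw [div_le_iff₀ hd0]
    calc tangentNorm F y ^ 2 ≤ (d * weylNorm F) ^ 2 :=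
          pow_le_pow_left₀ (tangentNorm_nonneg F y) h2 2
      _ = _ := by ring
  rw [Real.sqrt_le_left (by positivity), mul_pow, Real.sq_sqrt (by positivity)]
  linarith

/-- Only the derivatives in the directions `1, …, n` come from `∂f`. Euler's identity eliminates the
one in direction `0`, at the price of the value term. Orthogonality to `(1,x)` gives `v_0 =
-⟨x,v'⟩`, whence `|v_0 s| ≤ ‖x‖‖v‖` and `‖v' - v_0 x‖ ≤ s‖v‖`. -/
theorem tangentNorm_homogenize_le (hd : 1 ≤ d) {f : MvPolynomial (Fin n) ℝ}
    (hf : f.totalDegree ≤ d) (x : EuclideanSpace ℝ (Fin n)) :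
    tangentNorm (homogenize d f) (sphereMap x) ≤
      d * ‖x‖ * |evalAt (homogenize d f) (sphereMap x)| +
        √(1 + ‖x‖ ^ 2) * ((√(1 + ‖x‖ ^ 2))⁻¹ ^ (d - 1) * ‖grad f x‖) := by
  set s := √(1 + ‖x‖ ^ 2) with hs
  have hs0 : 0 < s := Real.sqrt_pos.2 (by positivity)
  have hs2 : s ^ 2 = 1 + ‖x‖ ^ 2 := Real.sq_sqrt (by positivity)
  refine tangentNorm_le (by positivity) fun v hv => ?_
  set F := homogenize d f with hF
  set e := evalAt F (sphereMap x) with he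
  set v' : EuclideanSpace ℝ (Fin n) := WithLp.toLp 2 fun i => v i.succ with hv'
  set g : EuclideanSpace ℝ (Fin n) := s⁻¹ ^ (d - 1) • grad f x with hg
  have hgi : ∀ i : Fin n, evalAt (pderiv i.succ F) (sphereMap x) = g i := fun i => by
    rw [evalAt_pderiv_homogenize_sphereMap hf]; rfl
  -- the orthogonality relation, Euler's identity and the norm of `v` in coordinates
  have horth : v 0 + inner ℝ x v' = 0 := by
    rw [PiLp.inner_apply, Fin.sum_univ_succ, sphereMap_apply_zero] at hv
    simp_rw [sphereMap_apply_succ] at hv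
    simp only [RCLike.inner_apply, conj_trivial] at hv
    rw [PiLp.inner_apply]
    simp only [RCLike.inner_apply, conj_trivial, hv']
    have : s⁻¹ * (v 0 + ∑ i, v i.succ * x i) = 0 := by
      rw [← hv, mul_add, Finset.mul_sum, mul_comm]
      congr 1
      exact Finset.sum_congr rfl fun i _ => by ring
    exact (mul_eq_zero.1 this).resolve_left (inv_pos.2 hs0).ne'
  have heuler : evalAt (pderiv 0 F) (sphereMap x) + inner ℝ x g = s * d * e := by
    have h := congrArg (fun p => evalAt p (sphereMap x))
      (isHomogeneous_homogenize hf).sum_X_mul_pderiv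
    simp only [evalAt, map_sum, map_mul, eval_X, nsmul_eq_mul, map_natCast] at h
    rw [Fin.sum_univ_succ, sphereMap_apply_zero] at h
    simp_rw [sphereMap_apply_succ] at h
    have h' : s⁻¹ * evalAt (pderiv 0 F) (sphereMap x) + ∑ i, s⁻¹ * x i * g i = d * e := by
      simp_rw [← hgi]
      exact h
    rw [PiLp.inner_apply]
    simp only [RCLike.inner_apply, conj_trivial]
    have h2 : ∑ i, s⁻¹ * x i * g i = s⁻¹ * ∑ i, g i * x i := by
      rw [Finset.mul_sum]
      exact Finset.sum_congr rfl fun i _ => by ring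
    rw [h2] at h'
    field_simp at h'
    linarith
  have hnorm : ‖v‖ ^ 2 = v 0 ^ 2 + ‖v'‖ ^ 2 := by
    rw [EuclideanSpace.real_norm_sq_eq, EuclideanSpace.real_norm_sq_eq, Fin.sum_univ_succ]
  have hsum : ∑ i, v i * evalAt (pderiv i F) (sphereMap x) =
      v 0 * s * d * e + inner ℝ (v' - v 0 • x) g := by
    rw [Fin.sum_univ_succ]
    simp_rw [hgi]
    have h2 : ∑ i : Fin n, v i.succ * g i = inner ℝ v' g := by
      rw [PiLp.inner_apply]
      simp [hv', mul_comm]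
    rw [h2, inner_sub_left, inner_smul_left]
    simp only [conj_trivial]
    linear_combination v 0 * heuler
  have hcs : inner ℝ x v' ^ 2 ≤ ‖x‖ ^ 2 * ‖v'‖ ^ 2 := by
    rw [← mul_pow, ← sq_abs]
    exact pow_le_pow_left₀ (abs_nonneg _) (abs_real_inner_le_norm x v') 2
  have hv0 : |v 0 * s| ≤ ‖x‖ * ‖v‖ := by
    refine abs_le_of_sq_le_sq ?_ (by positivity)
    have h1 : v 0 ^ 2 = inner ℝ x v' ^ 2 := by
      rw [show v 0 = -inner ℝ x v' by linarith]; ring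
    nlinarith
  have hw : ‖v' - v 0 • x‖ ≤ s * ‖v‖ := by
    refine le_of_sq_le_sq ?_ (by positivity)
    rw [norm_sub_sq_real, inner_smul_right, real_inner_comm, norm_smul, mul_pow, mul_pow, hs2,
      Real.norm_eq_abs, sq_abs, show inner ℝ x v' = -v 0 by linarith, hnorm]
    rw [show inner ℝ x v' = -v 0 by linarith] at hcs
    nlinarith
  have hgn : ‖g‖ = s⁻¹ ^ (d - 1) * ‖grad f x‖ := by
    rw [hg, norm_smul, Real.norm_of_nonneg (by positivity)]
  rw [hsum, ← hgn]
  calc |v 0 * s * d * e + inner ℝ (v' - v 0 • x) g|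
      ≤ |v 0 * s * d * e| + |inner ℝ (v' - v 0 • x) g| := abs_add_le _ _
    _ ≤ (‖x‖ * ‖v‖) * (d * |e|) + s * ‖v‖ * ‖g‖ := by
        refine add_le_add ?_ ?_
        · rw [mul_assoc, abs_mul, abs_mul (d : ℝ), Nat.abs_cast]
          exact mul_le_mul_of_nonneg_right hv0 (by positivity)
        · exact (abs_real_inner_le_norm _ _).trans (by gcongr)
    _ = _ := by ring

/-- The reciprocal of the condition number at `x` in terms of `f(x)` and `∂f(x)`. -/
theorem sqrt_eval_tangent_le (hd : 1 ≤ d) {f : MvPolynomial (Fin n) ℝ}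
    (hf : f.totalDegree ≤ d) (x : EuclideanSpace ℝ (Fin n)) :
    √(evalAt (homogenize d f) (sphereMap x) ^ 2 +
        tangentNorm (homogenize d f) (sphereMap x) ^ 2 / d) ≤
      √d * ((|evalAt f x| + √(1 + ‖x‖ ^ 2) * ‖grad f x‖ / d) / √(1 + ‖x‖ ^ 2) ^ (d - 1)) := by
  have hT := tangentNorm_homogenize_le hd hf x
  have hT0 := tangentNorm_nonneg (homogenize d f) (sphereMap x)
  have he := evalAt_homogenize_sphereMap hf x
  set s := √(1 + ‖x‖ ^ 2) with hs
  have hs0 : 0 < s := Real.sqrt_pos.2 (by positivity)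
  have hs2 : s ^ 2 = 1 + ‖x‖ ^ 2 := Real.sq_sqrt (by positivity)
  have hxs : ‖x‖ ≤ s := by
    refine le_of_sq_le_sq ?_ hs0.le
    linarith
  set e := evalAt (homogenize d f) (sphereMap x)
  set T := tangentNorm (homogenize d f) (sphereMap x)
  set G := ‖grad f x‖ with hG
  have hG0 : 0 ≤ G := norm_nonneg _
  have hd1 : (1 : ℝ) ≤ d := by exact_mod_cast hd
  have hd0 : (0 : ℝ) < d := by linarith
  have hfe : |evalAt f x| / s ^ (d - 1) = s * |e| := by
    rw [he, abs_mul, inv_pow, abs_of_pos (inv_pos.2 (pow_pos hs0 d))]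
    obtain ⟨k, rfl⟩ : ∃ k, d = k + 1 := ⟨d - 1, by omega⟩
    rw [Nat.add_sub_cancel, pow_succ]
    field_simp
  set h := s * (s⁻¹ ^ (d - 1) * G) / d with hh
  have hh0 : 0 ≤ h := by positivity
  have hge : s * G / d / s ^ (d - 1) = h := by
    rw [hh, inv_pow]; field_simp
  have hTh : T ≤ d * (‖x‖ * |e| + h) := by
    refine hT.trans (le_of_eq ?_)
    rw [hh]; field_simp
  rw [add_div, hfe, hge, Real.sqrt_le_left (by positivity), mul_pow, Real.sq_sqrt hd0.le]
  have h1 : T ^ 2 / d ≤ d * (‖x‖ * |e| + h) ^ 2 := by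
    rw [div_le_iff₀ hd0]
    calc T ^ 2 ≤ (d * (‖x‖ * |e| + h)) ^ 2 := pow_le_pow_left₀ hT0 hTh 2
      _ = _ := by ring
  have h2 : e ^ 2 ≤ d * |e| ^ 2 := by
    rw [sq_abs]; nlinarith [sq_nonneg e]
  -- The squares of `e` combine exactly by `1 + ‖x‖² = s²`; the cross term uses `‖x‖ ≤ s`.
  have h3 : |e| ^ 2 + (‖x‖ * |e| + h) ^ 2 ≤ (s * |e| + h) ^ 2 := by
    have h4 : ‖x‖ * (|e| * h) ≤ s * (|e| * h) := by gcongr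
    have h5 : s ^ 2 * |e| ^ 2 = (1 + ‖x‖ ^ 2) * |e| ^ 2 := by rw [hs2]
    nlinarith
  have h4 := mul_le_mul_of_nonneg_left h3 hd0.le
  linarith

end PV

namespace PV

open MvPolynomial

/-! ### The radius of the centered form -/

section L1

variable {σ : Type*}

/-- The weighted `ℓ¹`-norm `∑_α |q_α| r^|α|` of a polynomial. -/
noncomputable def l1 (r : ℝ) (q : MvPolynomial σ ℝ) : ℝ :=
  ∑ α ∈ q.support, |q.coeff α| * r ^ α.degree

variable {r : ℝ}

theorem l1_eq_sum_of_subset {q : MvPolynomial σ ℝ} {S : Finset (σ →₀ ℕ)} (hS : q.support ⊆ S) :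
    l1 r q = ∑ α ∈ S, |q.coeff α| * r ^ α.degree :=
  Finset.sum_subset hS fun α _ hα => by simp [notMem_support_iff.1 hα]

theorem l1_add_le (hr : 0 ≤ r) (p q : MvPolynomial σ ℝ) : l1 r (p + q) ≤ l1 r p + l1 r q := by
  classical
  rw [l1_eq_sum_of_subset (support_add (p := p) (q := q)),
    l1_eq_sum_of_subset (Finset.subset_union_left (s₁ := p.support) (s₂ := q.support)),
    l1_eq_sum_of_subset (Finset.subset_union_right (s₁ := p.support) (s₂ := q.support)),
    ← Finset.sum_add_distrib]
  refine Finset.sum_le_sum fun α _ => ?_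
  rw [← add_mul, coeff_add]
  exact mul_le_mul_of_nonneg_right (abs_add_le _ _) (by positivity)

theorem l1_zero : l1 r (0 : MvPolynomial σ ℝ) = 0 := by simp [l1]

theorem l1_nonneg (hr : 0 ≤ r) (q : MvPolynomial σ ℝ) : 0 ≤ l1 r q :=
  Finset.sum_nonneg fun _ _ => by positivity

theorem l1_sum_le (hr : 0 ≤ r) {ι : Type*} (s : Finset ι) (q : ι → MvPolynomial σ ℝ) :
    l1 r (∑ i ∈ s, q i) ≤ ∑ i ∈ s, l1 r (q i) :=
  Finset.le_sum_of_subadditive (l1 r) l1_zero.le (l1_add_le hr) s q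

theorem l1_monomial (α : σ →₀ ℕ) (c : ℝ) : l1 r (monomial α c) = |c| * r ^ α.degree := by
  classical
  rw [l1_eq_sum_of_subset support_monomial_subset]
  simp [coeff_monomial]

theorem l1_C (c : ℝ) : l1 r (C c : MvPolynomial σ ℝ) = |c| := by
  rw [C_apply, l1_monomial]; simp

theorem l1_X (i : σ) : l1 r (X i : MvPolynomial σ ℝ) = r := by
  rw [X, l1_monomial]; simp

theorem l1_mul_le (hr : 0 ≤ r) (p q : MvPolynomial σ ℝ) : l1 r (p * q) ≤ l1 r p * l1 r q := by
  conv_lhs => rw [p.as_sum, q.as_sum, Finset.sum_mul_sum]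
  refine (l1_sum_le hr _ _).trans ?_
  simp only [l1, Finset.sum_mul_sum]
  refine Finset.sum_le_sum fun α _ => (l1_sum_le hr _ _).trans ?_
  refine Finset.sum_le_sum fun β _ => le_of_eq ?_
  rw [monomial_mul, l1_monomial, abs_mul, map_add, pow_add]
  ring

theorem l1_pow_le (hr : 0 ≤ r) (p : MvPolynomial σ ℝ) (k : ℕ) : l1 r (p ^ k) ≤ l1 r p ^ k := by
  induction k with
  | zero => rw [pow_zero, pow_zero, ← C_1, l1_C]; simp
  | succ k ih =>
    rw [pow_succ, pow_succ]
    exact (l1_mul_le hr _ _).trans (mul_le_mul_of_nonneg_right ih (l1_nonneg hr p))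

theorem l1_prod_le (hr : 0 ≤ r) {ι : Type*} (s : Finset ι) (q : ι → MvPolynomial σ ℝ) :
    l1 r (∏ i ∈ s, q i) ≤ ∏ i ∈ s, l1 r (q i) := by
  classical
  induction s using Finset.induction_on with
  | empty => rw [Finset.prod_empty, Finset.prod_empty, ← C_1, l1_C]; simp
  | insert i s hi ih =>
    rw [Finset.prod_insert hi, Finset.prod_insert hi]
    exact (l1_mul_le hr _ _).trans (mul_le_mul_of_nonneg_left ih (l1_nonneg hr _))

theorem l1_C_mul_le (hr : 0 ≤ r) (c : ℝ) (q : MvPolynomial σ ℝ) :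
    l1 r (C c * q) ≤ |c| * l1 r q :=
  (l1_mul_le hr _ _).trans_eq (by rw [l1_C])

theorem l1_rename_le (hr : 0 ≤ r) {τ : Type*} (φ : σ → τ) (q : MvPolynomial σ ℝ) :
    l1 r (rename φ q) ≤ l1 r q := by
  conv_lhs => rw [q.as_sum, map_sum]
  refine (l1_sum_le hr _ _).trans (Finset.sum_le_sum fun α _ => le_of_eq ?_)
  rw [rename_monomial, l1_monomial, Finsupp.degree_mapDomain]

theorem abs_eval_le_l1 [Fintype σ] (q : MvPolynomial σ ℝ) {t : σ → ℝ}
    (ht : ∀ i, |t i| ≤ r) : |eval t q| ≤ l1 r q := by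
  rw [eval_eq']
  refine (Finset.abs_sum_le_sum_abs _ _).trans (Finset.sum_le_sum fun α _ => ?_)
  rw [abs_mul, Finset.abs_prod, Finsupp.degree_eq_sum, ← Finset.prod_pow_eq_pow_sum]
  refine mul_le_mul_of_nonneg_left ?_ (abs_nonneg _)
  refine Finset.prod_le_prod (fun i _ => abs_nonneg _) fun i _ => ?_
  rw [abs_pow]
  exact pow_le_pow_left₀ (abs_nonneg _) (ht i) _

theorem support_sub_C_coeff_zero [DecidableEq (σ →₀ ℕ)] (q : MvPolynomial σ ℝ) :
    (q - C (q.coeff 0)).support = q.support.erase 0 := by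
  classical
  ext α
  by_cases hα : α = 0
  · simp [hα]
  · simp [hα, Ne.symm hα, coeff_C]

theorem l1_sub_C_coeff_zero_eq_sum [DecidableEq (σ →₀ ℕ)] (q : MvPolynomial σ ℝ) :
    l1 r (q - C (q.coeff 0)) = ∑ α ∈ q.support.erase 0, |q.coeff α| * r ^ α.degree := by
  rw [l1, support_sub_C_coeff_zero]
  refine Finset.sum_congr rfl fun α hα => ?_
  classical
  simp [coeff_C, (Finset.ne_of_mem_erase hα).symm]

theorem l1_sub_C_coeff_zero (q : MvPolynomial σ ℝ) :
    l1 r (q - C (q.coeff 0)) = l1 r q - |q.coeff 0| := by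
  classical
  rw [l1_sub_C_coeff_zero_eq_sum, l1_eq_sum_of_subset (Finset.subset_insert 0 q.support),
    ← Finset.insert_erase (Finset.mem_insert_self 0 q.support),
    Finset.sum_insert (Finset.notMem_erase _ _)]
  simp

end L1

/-! ### Centered forms through the shifted polynomial. -/

section Taylor

variable {σ : Type*}

/-- The polynomial `p(c + X)`. -/
noncomputable def shift (c : σ → ℝ) : MvPolynomial σ ℝ →ₐ[ℝ] MvPolynomial σ ℝ :=
  bind₁ fun i => X i + C (c i)

theorem eval_shift (c t : σ → ℝ) (p : MvPolynomial σ ℝ) :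
    eval t (shift c p) = eval (fun i => t i + c i) p := by
  rw [shift, ← coe_aeval_eq_eval, ← coe_aeval_eq_eval, RingHom.coe_coe, RingHom.coe_coe,
    aeval_bind₁]
  simp

theorem coeff_zero_shift (c : σ → ℝ) (p : MvPolynomial σ ℝ) :
    (shift c p).coeff 0 = eval c p := by
  have h := eval_shift c (fun _ => 0) p
  simp only [zero_add] at h
  rw [← h, ← constantCoeff_eq]
  exact (congrFun (congrArg DFunLike.coe (eval_zero' (R := ℝ) (σ := σ))) _).symm

theorem taylorRadius_eq_l1 (p : MvPolynomial σ ℝ) (c : σ → ℝ) (w : ℝ) :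
    taylorRadius p c w = l1 (w / 2) (shift c p - C (eval c p)) := by
  classical
  rw [← coeff_zero_shift, l1_sub_C_coeff_zero_eq_sum, taylorRadius]
  unfold taylorCoeff shift
  congr!

theorem taylorRadius_nonneg (p : MvPolynomial σ ℝ) (c : σ → ℝ) {w : ℝ} (hw : 0 ≤ w) :
    0 ≤ taylorRadius p c w := by
  rw [taylorRadius_eq_l1]
  exact l1_nonneg (by positivity) _

theorem abs_eval_sub_eval_le_taylorRadius [Fintype σ] (p : MvPolynomial σ ℝ) {c x : σ → ℝ} {w : ℝ}
    (hx : ∀ i, |x i - c i| ≤ w / 2) :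
    |eval x p - eval c p| ≤ taylorRadius p c w := by
  rw [taylorRadius_eq_l1]
  have := abs_eval_le_l1 (shift c p - C (eval c p)) hx
  rw [map_sub, eval_shift, eval_C] at this
  simpa using this

/-- Removing the constant term lowers the `ℓ¹`-norm by exactly its absolute value, and
submultiplicativity bounds the norm of `∏ (X_i + c_i)^β_i`. The outcome is a difference of monomials
at `|c| + w/2` and `|c|`. -/
theorem taylorRadius_le_sum [Fintype σ] (p : MvPolynomial σ ℝ) (c : σ → ℝ) {w : ℝ} (hw : 0 ≤ w) :
    taylorRadius p c w ≤
      ∑ β ∈ p.support, |p.coeff β| * (∏ i, (|c i| + w / 2) ^ β i - ∏ i, |c i| ^ β i) := by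
  have hr : 0 ≤ w / 2 := by positivity
  have hsum : shift c p - C (eval c p) = ∑ β ∈ p.support, C (p.coeff β) *
      (∏ i, (X i + C (c i)) ^ β i - C (∏ i, c i ^ β i)) := by
    have h : shift c p = ∑ β ∈ p.support, shift c (monomial β (p.coeff β)) := by
      rw [← map_sum, ← p.as_sum]
    rw [h, eval_eq', map_sum, ← Finset.sum_sub_distrib]
    refine Finset.sum_congr rfl fun β _ => ?_
    rw [mul_sub, ← C_mul, shift, bind₁_monomial]
    congr 2
    exact Finset.prod_subset (Finset.subset_univ _) fun i _ hi => by
      rw [Finsupp.notMem_support_iff.1 hi, pow_zero]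
  rw [taylorRadius_eq_l1, hsum]
  refine (l1_sum_le hr _ _).trans (Finset.sum_le_sum fun β _ => ?_)
  refine (l1_C_mul_le hr _ _).trans (mul_le_mul_of_nonneg_left ?_ (abs_nonneg _))
  set q : MvPolynomial σ ℝ := ∏ i, (X i + C (c i)) ^ β i with hq
  have h0 : q.coeff 0 = ∏ i, c i ^ β i := by
    rw [hq, ← constantCoeff_eq, map_prod]
    simp
  have h1 : l1 (w / 2) q ≤ ∏ i, (|c i| + w / 2) ^ β i := by
    refine (l1_prod_le hr _ _).trans (Finset.prod_le_prod (fun i _ => l1_nonneg hr _) fun i _ => ?_)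
    refine (l1_pow_le hr _ _).trans (pow_le_pow_left₀ (l1_nonneg hr _) ?_ _)
    refine (l1_add_le hr _ _).trans_eq ?_
    rw [l1_X, l1_C, add_comm]
  rw [← h0, l1_sub_C_coeff_zero, h0, Finset.abs_prod]
  simp_rw [abs_pow]
  exact sub_le_sub_right h1 _

end Taylor

variable {n d : ℕ}

/-- The radius of the centered form is bounded by the Weyl norm. -/
theorem taylorRadius_le_weylNorm {p : MvPolynomial (Fin n) ℝ}
    (hp : (homogenize d p).IsHomogeneous d) (c : EuclideanSpace ℝ (Fin n)) {w : ℝ} (hw : 0 ≤ w) :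
    taylorRadius p (fun i => c i) w ≤ weylNorm (homogenize d p) *
      (d * (√(1 + ‖c‖ ^ 2) + √n * (w / 2)) ^ (d - 1) * (√n * (w / 2))) := by
  have hr : 0 ≤ w / 2 := by positivity
  -- The homogenizing coordinate is `1` in both points, so `u - z` has norm `√n w/2`; the absolute
  -- values do not change the norm of `(1,c)`.
  set u : Fin (n + 1) → ℝ := Fin.cons 1 fun i => |c i| + w / 2 with hu
  set z : Fin (n + 1) → ℝ := Fin.cons 1 fun i => |c i| with hz
  have hzn : √(∑ i, z i ^ 2) = √(1 + ‖c‖ ^ 2) := by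
    rw [← sum_sq_cons_one, Fin.sum_univ_succ, Fin.sum_univ_succ]
    simp [hz]
  have huz : √(∑ i, (u i - z i) ^ 2) = √n * (w / 2) := by
    rw [Fin.sum_univ_succ]
    simp [hu, hz, Real.sqrt_sq hr]
  have hun : √(∑ i, u i ^ 2) ≤ √(1 + ‖c‖ ^ 2) + √n * (w / 2) := by
    have h := norm_add_le (WithLp.toLp 2 z : EuclideanSpace ℝ (Fin (n + 1))) (WithLp.toLp 2 (u - z))
    rw [← WithLp.toLp_add, add_sub_cancel] at h
    simp only [EuclideanSpace.norm_eq, Real.norm_eq_abs, sq_abs, Pi.sub_apply] at h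
    rwa [hzn, huz] at h
  have h := sum_abs_coeff_mul_sub_le hp u z hun
    (hzn.trans_le (le_add_of_nonneg_right (by positivity)))
  rw [huz, sum_support_homogenize] at h
  refine (taylorRadius_le_sum p _ hw).trans (le_trans (Finset.sum_le_sum fun β _ => ?_) h)
  rw [coeff_homogenize_cons, prod_pow_cons, prod_pow_cons]
  simp only [one_pow, one_mul]
  exact mul_le_mul_of_nonneg_left (le_abs_self _) (abs_nonneg _)

theorem sqrt_sum_sq_taylorRadius_pderiv_le {f : MvPolynomial (Fin n) ℝ} (hf : f.totalDegree ≤ d)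
    (c : EuclideanSpace ℝ (Fin n)) {w : ℝ} (hw : 0 ≤ w) :
    √(∑ i, taylorRadius (pderiv i f) (fun i => c i) w ^ 2) ≤ d * weylNorm (homogenize d f) *
      ((d - 1 : ℕ) * (√(1 + ‖c‖ ^ 2) + √n * (w / 2)) ^ (d - 1 - 1) * (√n * (w / 2))) := by
  have hW := weylNorm_nonneg (homogenize d f)
  have hF := isHomogeneous_homogenize hf
  set K := ((d - 1 : ℕ) * (√(1 + ‖c‖ ^ 2) + √n * (w / 2)) ^ (d - 1 - 1) * (√n * (w / 2)))
  have hK : 0 ≤ K := by positivity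
  rw [Real.sqrt_le_left (by positivity)]
  calc ∑ i, taylorRadius (pderiv i f) (fun i => c i) w ^ 2
      ≤ ∑ i : Fin n, weylNorm (pderiv i.succ (homogenize d f)) ^ 2 * K ^ 2 := by
        refine Finset.sum_le_sum fun i _ => ?_
        rw [← mul_pow]
        refine pow_le_pow_left₀ (taylorRadius_nonneg _ _ hw) ?_ 2
        rw [pderiv_succ_homogenize]
        refine taylorRadius_le_weylNorm ?_ c hw
        rw [← pderiv_succ_homogenize]
        exact hF.pderiv
    _ ≤ (d * weylNorm (homogenize d f)) ^ 2 * K ^ 2 := by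
        rw [← Finset.sum_mul]
        refine mul_le_mul_of_nonneg_right (le_trans ?_ (sum_sq_weylNorm_pderiv_le hF)) (sq_nonneg K)
        rw [Fin.sum_univ_succ]
        exact le_add_of_nonneg_left (sq_nonneg _)
    _ = _ := (mul_pow _ _ 2).symm

theorem shift_rename {σ τ : Type*} (φ : σ → τ) (c : τ → ℝ) (p : MvPolynomial σ ℝ) :
    shift c (rename φ p) = rename φ (shift (c ∘ φ) p) := by
  rw [shift, shift, bind₁_rename, rename_bind₁]
  simp [Function.comp_def]

/-- The radius of the centered form of `⟨∂f(X), ∂f(Y)⟩`. -/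
theorem taylorRadius_gradProd_le (f : MvPolynomial (Fin n) ℝ) (c : Fin n → ℝ) {w : ℝ}
    (hw : 0 ≤ w) :
    taylorRadius (gradProd f) (Sum.elim c c) w ≤
      ∑ i, (2 * |eval c (pderiv i f)| * taylorRadius (pderiv i f) c w +
        taylorRadius (pderiv i f) c w ^ 2) := by
  have hr : 0 ≤ w / 2 := by positivity
  set A : Fin n → MvPolynomial (Fin n) ℝ := fun i =>
    shift c (pderiv i f) - C (eval c (pderiv i f)) with hA
  -- With `g = ∂f(c)` and `A_i` the non-constant part of the shifted `∂_i f`, this expands `(g_i +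
  -- A_i(X))(g_i + A_i(Y)) - g_i²`.
  have hsum : shift (Sum.elim c c) (gradProd f) - C (eval (Sum.elim c c) (gradProd f)) =
      ∑ i, (C (eval c (pderiv i f)) * rename Sum.inr (A i) +
        C (eval c (pderiv i f)) * rename Sum.inl (A i) +
          rename Sum.inl (A i) * rename Sum.inr (A i)) := by
    rw [gradProd, map_sum, map_sum, map_sum, ← Finset.sum_sub_distrib]
    refine Finset.sum_congr rfl fun i _ => ?_
    rw [map_mul, map_mul, map_mul, shift_rename, shift_rename, eval_rename, eval_rename,
      Sum.elim_comp_inl, Sum.elim_comp_inr]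
    simp only [hA, map_sub, rename_C]
    ring
  rw [taylorRadius_eq_l1, hsum]
  refine (l1_sum_le hr _ _).trans (Finset.sum_le_sum fun i _ => ?_)
  have hl : ∀ φ : Fin n → Fin n ⊕ Fin n,
      l1 (w / 2) (rename φ (A i)) ≤ taylorRadius (pderiv i f) c w := fun φ => by
    rw [taylorRadius_eq_l1]; exact l1_rename_le hr φ _
  have hC : ∀ φ : Fin n → Fin n ⊕ Fin n, l1 (w / 2) (C (eval c (pderiv i f)) * rename φ (A i)) ≤
      |eval c (pderiv i f)| * taylorRadius (pderiv i f) c w := fun φ =>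
    (l1_C_mul_le hr _ _).trans (mul_le_mul_of_nonneg_left (hl φ) (abs_nonneg _))
  have h1 := (l1_mul_le hr (rename Sum.inl (A i)) (rename Sum.inr (A i))).trans
    (mul_le_mul (hl Sum.inl) (hl Sum.inr) (l1_nonneg hr _) (taylorRadius_nonneg _ _ hw))
  have h2 := l1_add_le hr (C (eval c (pderiv i f)) * rename Sum.inr (A i) +
    C (eval c (pderiv i f)) * rename Sum.inl (A i)) (rename Sum.inl (A i) * rename Sum.inr (A i))
  have h3 := l1_add_le hr (C (eval c (pderiv i f)) * rename Sum.inr (A i))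
    (C (eval c (pderiv i f)) * rename Sum.inl (A i))
  linarith [hC Sum.inl, hC Sum.inr]

end PV

namespace PV

open MvPolynomial MeasureTheory

variable {n d : ℕ}

/-! ### From the condition number to the number of cubes -/

theorem toSet_rootCube (a : ℝ) (ha : 0 < a) :
    (rootCube n a ha).toSet = {x | ∀ i, x i ∈ Set.Icc (-a) a} := by
  ext x
  simp [Cube.toSet, rootCube, abs_le]

theorem volume_setOf_mem_Icc (a : ℝ) :
    volume {x : EuclideanSpace ℝ (Fin n) | ∀ i, x i ∈ Set.Icc (-a) a} =
      ENNReal.ofReal (2 * a) ^ n := by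
  have h : {x : EuclideanSpace ℝ (Fin n) | ∀ i, x i ∈ Set.Icc (-a) a} =
      WithLp.ofLp ⁻¹' (Set.univ.pi fun _ => Set.Icc (-a) a) := by
    ext x
    simp only [Set.mem_ofPred_eq, Set.mem_preimage, Set.mem_univ_pi]
  rw [h, (PiLp.volume_preserving_ofLp (Fin n)).measure_preimage
    (MeasurableSet.univ_pi fun _ => measurableSet_Icc).nullMeasurableSet, volume_pi_pi]
  simp [two_mul]

theorem lintegral_kappaAff_pow (f : MvPolynomial (Fin n) ℝ) {a : ℝ} (ha : 0 < a) :
    ∫⁻ x in {x : EuclideanSpace ℝ (Fin n) | ∀ i, x i ∈ Set.Icc (-a) a}, kappaAff d f x ^ n =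
      ENNReal.ofReal (2 * a) ^ n * meanKappaPow d f a := by
  rw [meanKappaPow, laverage_eq, Measure.restrict_apply_univ, volume_setOf_mem_Icc]
  refine (ENNReal.mul_div_cancel ?_ (by finiteness)).symm
  exact pow_ne_zero _ (by simpa using ha)

/-- Needed to absorb the single cube of a run that stops at once into the bound by the mean. -/
theorem le_meanKappaPow (hd : 1 ≤ d) {f : MvPolynomial (Fin n) ℝ} (hf : f ≠ 0)
    (hdeg : f.totalDegree ≤ d) {a : ℝ} (ha : 0 < a) :
    ENNReal.ofReal (√(1 + d))⁻¹ ^ n ≤ meanKappaPow d f a := by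
  have hW := weylNorm_pos (homogenize_ne_zero d hf)
  have hk : ∀ x, ENNReal.ofReal (√(1 + d))⁻¹ ≤ kappaAff d f x := by
    intro x
    have hQ := sqrt_eval_tangent_le_weylNorm hd (isHomogeneous_homogenize hdeg) (norm_sphereMap x)
    have hs : 0 < √(1 + (d : ℝ)) := Real.sqrt_pos.2 (by positivity)
    rw [kappaAff, kappa, ENNReal.le_div_iff_mul_le (Or.inr (by simpa using hW))
      (Or.inl ENNReal.ofReal_ne_top), ← ENNReal.ofReal_mul (by positivity)]
    refine ENNReal.ofReal_le_ofReal ?_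
    rw [inv_mul_le_iff₀ hs]
    exact hQ
  have h0 : ENNReal.ofReal (2 * a) ^ n ≠ 0 := pow_ne_zero _ (by simpa using ha)
  have ht : ENNReal.ofReal (2 * a) ^ n ≠ ⊤ := by finiteness
  rw [← ENNReal.mul_le_mul_iff_right h0 ht, ← lintegral_kappaAff_pow f ha,
    ← volume_setOf_mem_Icc, mul_comm, ← setLIntegral_const]
  exact lintegral_mono fun x => pow_le_pow_left₀ zero_le (hk x) n

/-- Stated without a division, the hypothesis also covers singular zeros. There `κ = ⊤`, because `f
≠ 0` makes the numerator positive. -/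
theorem one_le_mul_kappaAff {f : MvPolynomial (Fin n) ℝ} (hf : f ≠ 0) {K w : ℝ} (hK : 0 < K)
    (hw : 0 < w) {x : EuclideanSpace ℝ (Fin n)}
    (h : √(evalAt (homogenize d f) (sphereMap x) ^ 2 +
        tangentNorm (homogenize d f) (sphereMap x) ^ 2 / d) ≤ K * w * affWeylNorm d f) :
    1 ≤ ENNReal.ofReal w * (ENNReal.ofReal K * kappaAff d f x) := by
  have hW := weylNorm_pos (homogenize_ne_zero d hf)
  rw [← mul_assoc, ← ENNReal.ofReal_mul hw.le, kappaAff, kappa, ← mul_div_assoc,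
    ← ENNReal.ofReal_mul (by positivity),
    ENNReal.le_div_iff_mul_le (Or.inr (by
      have : 0 < w * K * weylNorm (homogenize d f) := by positivity
      simpa using this)) (Or.inl ENNReal.ofReal_ne_top), one_mul]
  refine ENNReal.ofReal_le_ofReal (h.trans_eq ?_)
  rw [affWeylNorm]
  ring

/-- If every failing cube `J ∋ x` has width at least `1 / (K κ(x))`, then the number of cubes is
at most `(4K)^n max(1, a^n) 𝔼 κ^n`. -/
theorem numCubes_le_meanKappaPow (hn : 1 ≤ n) (hd : 1 ≤ d) {f : MvPolynomial (Fin n) ℝ}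
    (hf : f ≠ 0) (hdeg : f.totalDegree ≤ d) {a : ℝ} (ha : 0 < a) {test : Cube n → Prop} {K : ℝ}
    (hK : d ≤ K)
    (h : ∀ J, ¬ test J → ∀ x ∈ J.toSet, √(evalAt (homogenize d f) (sphereMap x) ^ 2 +
        tangentNorm (homogenize d f) (sphereMap x) ^ 2 / d) ≤ K * J.width * affWeylNorm d f) :
    (numCubes test (rootCube n a ha) : ℝ≥0∞) ≤
      ENNReal.ofReal ((4 * K) ^ n) * max 1 (ENNReal.ofReal (a ^ n)) * meanKappaPow d f a := by
  have hd1 : (1 : ℝ) ≤ d := by exact_mod_cast hd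
  have hK0 : 0 < K := by linarith
  refine (numCubes_le (L := fun x => ENNReal.ofReal K * kappaAff d f x) hn fun J hJ x hx =>
    one_le_mul_kappaAff hf hK0 J.width_pos (h J hJ x hx)).trans (max_le ?_ ?_)
  · calc (1 : ℝ≥0∞) ≤ ENNReal.ofReal ((4 * K) ^ n) * 1 * ENNReal.ofReal (√(1 + d))⁻¹ ^ n := by
          rw [mul_one, ← ENNReal.ofReal_pow (by positivity), ← ENNReal.ofReal_mul (by positivity),
            ← mul_pow, ENNReal.one_le_ofReal]
          refine one_le_pow₀ ?_
          rw [← div_eq_mul_inv, one_le_div (Real.sqrt_pos.2 (by positivity)),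
            Real.sqrt_le_left (by positivity)]
          nlinarith
      _ ≤ _ := by
          gcongr
          · exact le_max_left _ _
          · exact le_meanKappaPow hd hf hdeg ha
  · rw [toSet_rootCube]
    simp_rw [← mul_assoc, mul_pow (2 * ENNReal.ofReal K)]
    -- Finiteness of the constant replaces measurability of `κ`.
    rw [lintegral_const_mul' _ _ (by finiteness), lintegral_kappaAff_pow f ha, ← mul_assoc]
    refine mul_le_mul_left ?_ _
    calc (2 * ENNReal.ofReal K) ^ n * ENNReal.ofReal (2 * a) ^ n
        = ENNReal.ofReal ((4 * K) ^ n) * ENNReal.ofReal (a ^ n) := by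
          have h2 : (2 : ℝ≥0∞) = ENNReal.ofReal 2 := by simp
          rw [h2, ← ENNReal.ofReal_mul (by norm_num), ← mul_pow,
            ← ENNReal.ofReal_mul (by positivity), ← ENNReal.ofReal_pow (by positivity),
            ← ENNReal.ofReal_mul (by positivity), ← mul_pow]
          congr 2
          ring
      _ ≤ _ := by gcongr; exact le_max_right _ _

/-- The sharp constant is `1 + √2 < 5/2`. Both forms of the gradient test lead to this quadratic
inequality. -/
theorem le_mul_of_sq_le {G r : ℝ} (hr : 0 ≤ r) (h : G ^ 2 ≤ 2 * G * r + r ^ 2) :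
    G ≤ 5 / 2 * r := by
  by_contra! hlt
  nlinarith

/-- Two orthogonal vectors cannot both be close to a long vector. -/
theorem norm_le_of_inner_eq_zero {E : Type*} [NormedAddCommGroup E] [InnerProductSpace ℝ E]
    {u v g : E} {r : ℝ} (hu : ‖u - g‖ ≤ r) (hv : ‖v - g‖ ≤ r) (h : inner ℝ u v = 0) :
    ‖g‖ ≤ 5 / 2 * r := by
  have hr : 0 ≤ r := (norm_nonneg _).trans hu
  refine le_mul_of_sq_le hr ?_
  have h1 : inner ℝ u v = ‖g‖ ^ 2 + inner ℝ g (v - g) + inner ℝ (u - g) g +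
      inner ℝ (u - g) (v - g) := by
    simp only [inner_sub_left, inner_sub_right, real_inner_self_eq_norm_sq]
    ring
  have h2 := (abs_le.1 (abs_real_inner_le_norm g (v - g))).1
  have h3 := (abs_le.1 (abs_real_inner_le_norm (u - g) g)).1
  have h4 := (abs_le.1 (abs_real_inner_le_norm (u - g) (v - g))).1
  have h5 : ‖g‖ * ‖v - g‖ ≤ ‖g‖ * r := by gcongr
  have h6 : ‖u - g‖ * ‖g‖ ≤ r * ‖g‖ := by gcongr
  have h7 : ‖u - g‖ * ‖v - g‖ ≤ r * r := by gcongr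
  nlinarith

/-! ### The linearized test -/

theorem rpow_eq_sqrt_pow (hd : 1 ≤ d) {q : ℝ} (hq : 0 ≤ q) :
    q ^ (((d : ℝ) - 1) / 2) = √q ^ (d - 1) := by
  rw [Real.sqrt_eq_rpow, ← Real.rpow_natCast, ← Real.rpow_mul hq, Nat.cast_sub hd]
  congr 1
  push_cast
  ring

theorem abs_evalAt_div_eq (hd : 1 ≤ d) {f : MvPolynomial (Fin n) ℝ} (hf : f ≠ 0)
    (x : EuclideanSpace ℝ (Fin n)) :
    |evalAt f x| / √(1 + ‖x‖ ^ 2) ^ (d - 1) = affWeylNorm d f * |hatF d f x| := by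
  have hW : 0 < affWeylNorm d f := weylNorm_pos (homogenize_ne_zero d hf)
  have hs0 : 0 < √(1 + ‖x‖ ^ 2) := Real.sqrt_pos.2 (by positivity)
  rw [hatF, rpow_eq_sqrt_pow hd (by positivity), abs_div, abs_of_pos (mul_pos hW (pow_pos hs0 _))]
  field_simp

theorem norm_grad_div_eq (hd : 1 ≤ d) {f : MvPolynomial (Fin n) ℝ} (hf : f ≠ 0)
    (x : EuclideanSpace ℝ (Fin n)) :
    √(1 + ‖x‖ ^ 2) * ‖grad f x‖ / d / √(1 + ‖x‖ ^ 2) ^ (d - 1) =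
      affWeylNorm d f * ‖hatGrad d f x‖ := by
  have hW : 0 < affWeylNorm d f := weylNorm_pos (homogenize_ne_zero d hf)
  have hd0 : (0 : ℝ) < d := by exact_mod_cast hd
  have hq : 0 < 1 + ‖x‖ ^ 2 := by positivity
  have hs0 : 0 < √(1 + ‖x‖ ^ 2) := Real.sqrt_pos.2 hq
  -- For `d = 1` the exponent is negative, so the power is written as a quotient instead of
  -- `s^(d-2)`.
  have he : (1 + ‖x‖ ^ 2) ^ ((d : ℝ) / 2 - 1) =
      √(1 + ‖x‖ ^ 2) ^ (d - 1) / √(1 + ‖x‖ ^ 2) := by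
    rw [← rpow_eq_sqrt_pow hd hq.le, Real.sqrt_eq_rpow, ← Real.rpow_sub hq]
    congr 1
    ring
  rw [hatGrad, he, norm_smul, Real.norm_of_nonneg (by positivity)]
  field_simp

theorem sqrt_eval_tangent_le_hat (hd : 1 ≤ d) {f : MvPolynomial (Fin n) ℝ} (hf : f ≠ 0)
    (hdeg : f.totalDegree ≤ d) (x : EuclideanSpace ℝ (Fin n)) :
    √(evalAt (homogenize d f) (sphereMap x) ^ 2 +
        tangentNorm (homogenize d f) (sphereMap x) ^ 2 / d) ≤
      √d * (affWeylNorm d f * (|hatF d f x| + ‖hatGrad d f x‖)) := by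
  have h := sqrt_eval_tangent_le hd hdeg x
  rwa [add_div, abs_evalAt_div_eq hd hf, norm_grad_div_eq hd hf, ← mul_add] at h

theorem sqrt_mul_one_add_sqrt_le {d : ℝ} (hd : 1 ≤ d) : √d * (1 + √d) ≤ 2 * d := by
  have h1 : √d ^ 2 = d := Real.sq_sqrt (by linarith)
  have h2 : 1 ≤ √d := Real.one_le_sqrt.2 hd
  nlinarith

theorem sqrt_mul_one_add_sqrt_sub_one_le {d : ℝ} (hd : 1 ≤ d) :
    √d * (1 + √(d - 1)) ≤ √2 * d := by
  have h1 : √d ^ 2 = d := Real.sq_sqrt (by linarith)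
  have h2 : √(d - 1) ^ 2 = d - 1 := Real.sq_sqrt (by linarith)
  have h3 : √2 ^ 2 = (2 : ℝ) := Real.sq_sqrt (by norm_num)
  have h4 : 1 + √(d - 1) ≤ √2 * √d := by
    refine le_of_sq_le_sq ?_ (by positivity)
    rw [mul_pow, h1, h3]
    nlinarith [sq_nonneg (√(d - 1) - 1)]
  calc √d * (1 + √(d - 1)) ≤ √d * (√2 * √d) := by gcongr
    _ = √2 * √d ^ 2 := by ring
    _ = _ := by rw [h1]

theorem sqrt_eval_tangent_le_of_not_pvTest_hat (hn : 1 ≤ n) (hd : 1 ≤ d)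
    {f : MvPolynomial (Fin n) ℝ} (hf : f ≠ 0) (hdeg : f.totalDegree ≤ d) {B : Cube n → Set ℝ}
    {D : Cube n → Set (EuclideanSpace ℝ (Fin n))}
    (hB : IsIntervalApprox (hatF d f) B) (hD : IsIntervalApprox (hatGrad d f) D)
    (hB' : FunBound d f B) (hD' : GradBound d f D) {J : Cube n} (hJ : ¬ pvTest B D J)
    {x : EuclideanSpace ℝ (Fin n)} (hx : x ∈ J.toSet) :
    √(evalAt (homogenize d f) (sphereMap x) ^ 2 +
        tangentNorm (homogenize d f) (sphereMap x) ^ 2 / d) ≤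
      4 * √2 * d * n * J.width * affWeylNorm d f := by
  have hW : 0 < affWeylNorm d f := weylNorm_pos (homogenize_ne_zero d hf)
  have hw := J.width_pos
  have hn1 : (1 : ℝ) ≤ n := by exact_mod_cast hn
  have hd1 : (1 : ℝ) ≤ d := by exact_mod_cast hd
  simp only [pvTest, not_or, not_not] at hJ
  obtain ⟨h0, u, hu, v, hv, huv⟩ := hJ
  have hF : |hatF d f x| ≤ (1 + √d) * √n * J.width := by
    have h1 := hB' J 0 h0
    have h2 := hB' J _ (hB J ⟨x, hx, rfl⟩)
    rw [Real.dist_eq, abs_le] at h1 h2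
    rw [abs_le]
    constructor <;> linarith [h1.1, h1.2, h2.1, h2.2]
  -- The midpoint contributes `5/2` radii and the passage to `x` one more; the radius carries the
  -- factor `1/2`.
  have hG : ‖hatGrad d f x‖ ≤ 7 / 4 * ((1 + √((d : ℝ) - 1)) * n * J.width) := by
    have h1 := hD' J u hu
    have h2 := hD' J v hv
    have h3 := hD' J _ (hD J ⟨x, hx, rfl⟩)
    rw [dist_eq_norm] at h1 h2 h3
    have h4 := norm_le_of_inner_eq_zero h1 h2 huv
    have h5 := norm_le_norm_add_norm_sub' (hatGrad d f x) (hatGrad d f J.mid)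
    linarith
  refine (sqrt_eval_tangent_le_hat hd hf hdeg x).trans ?_
  have hsn : √(n : ℝ) ≤ n := by
    rw [Real.sqrt_le_left (by positivity)]
    nlinarith
  have hF' : √d * |hatF d f x| ≤ 2 * d * (n * J.width) := by
    calc √d * |hatF d f x| ≤ √d * ((1 + √d) * √n * J.width) := by gcongr
      _ = √d * (1 + √d) * (√n * J.width) := by ring
      _ ≤ 2 * d * (n * J.width) :=
          mul_le_mul (sqrt_mul_one_add_sqrt_le hd1) (by gcongr) (by positivity) (by positivity)
  have hG' : √d * ‖hatGrad d f x‖ ≤ 7 / 4 * √2 * d * (n * J.width) := by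
    calc √d * ‖hatGrad d f x‖ ≤ √d * (7 / 4 * ((1 + √((d : ℝ) - 1)) * n * J.width)) := by gcongr
      _ = 7 / 4 * (√d * (1 + √((d : ℝ) - 1))) * (n * J.width) := by ring
      _ ≤ 7 / 4 * (√2 * d) * (n * J.width) := by
          refine mul_le_mul_of_nonneg_right ?_ (by positivity)
          exact mul_le_mul_of_nonneg_left (sqrt_mul_one_add_sqrt_sub_one_le hd1) (by norm_num)
      _ = _ := by ring
  have h2 : 2 + 7 / 4 * √2 ≤ 4 * √2 := by
    have : (1 : ℝ) ≤ √2 := Real.one_le_sqrt.2 (by norm_num)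
    linarith
  calc √d * (affWeylNorm d f * (|hatF d f x| + ‖hatGrad d f x‖))
      = affWeylNorm d f * (√d * |hatF d f x| + √d * ‖hatGrad d f x‖) := by ring
    _ ≤ affWeylNorm d f * (2 * d * (n * J.width) + 7 / 4 * √2 * d * (n * J.width)) := by gcongr
    _ = affWeylNorm d f * ((2 + 7 / 4 * √2) * (d * (n * J.width))) := by ring
    _ ≤ affWeylNorm d f * (4 * √2 * (d * (n * J.width))) := by gcongr
    _ = _ := by ring

/-! ### The tests with centered forms -/

theorem mem_taylorForm_iff {σ : Type*} {p : MvPolynomial σ ℝ} {c : σ → ℝ} {w t : ℝ} :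
    t ∈ taylorForm p c w ↔ |t - eval c p| ≤ taylorRadius p c w := by
  rw [taylorForm, Set.mem_Icc, abs_le]
  constructor <;> rintro ⟨h1, h2⟩ <;> constructor <;> linarith

theorem norm_le_sqrt_sum_sq {v : EuclideanSpace ℝ (Fin n)} {ρ : Fin n → ℝ}
    (h : ∀ i, |v i| ≤ ρ i) : ‖v‖ ≤ √(∑ i, ρ i ^ 2) := by
  rw [EuclideanSpace.norm_eq]
  exact Real.sqrt_le_sqrt (Finset.sum_le_sum fun i _ =>
    pow_le_pow_left₀ (norm_nonneg _) (h i) 2)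

theorem sqrt_one_add_sq_le {A B δ : ℝ} (hδ : 0 ≤ δ) (h : B ≤ A + δ) (hB : 0 ≤ B) :
    √(1 + B ^ 2) ≤ √(1 + A ^ 2) + δ := by
  have hs : √(1 + A ^ 2) ^ 2 = 1 + A ^ 2 := Real.sq_sqrt (by positivity)
  have hAs : A ≤ √(1 + A ^ 2) := Real.le_sqrt_of_sq_le (by linarith)
  rw [Real.sqrt_le_left (by positivity)]
  nlinarith [mul_le_mul_of_nonneg_right hAs hδ, pow_le_pow_left₀ hB h 2]

/-- The estimates produce `8√n`; weakening it to `8^n` leads to the factor `2^(3n²)` of the bound.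
-/
theorem eight_mul_le_eight_pow (hn : 1 ≤ n) : 8 * (n : ℝ) ≤ 8 ^ n := by
  have : 8 * n ≤ 8 ^ n := by
    obtain ⟨k, rfl⟩ : ∃ k, n = k + 1 := ⟨n - 1, by omega⟩
    rw [pow_succ, mul_comm]
    exact Nat.mul_le_mul_right 8 (Nat.lt_pow_self (by norm_num))
  exact_mod_cast this

theorem one_add_pow_le {δ : ℝ} (hδ : 0 ≤ δ) (h : d * δ ≤ 1 / 4) : (1 + δ) ^ (d - 1) ≤ 4 / 3 := by
  calc (1 + δ) ^ (d - 1) ≤ (1 + δ) ^ d := pow_le_pow_right₀ (by linarith) (Nat.sub_le d 1)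
    _ ≤ Real.exp δ ^ d := by
        refine pow_le_pow_left₀ (by linarith) ?_ d
        linarith [Real.add_one_le_exp δ]
    _ = Real.exp (d * δ) := by rw [← Real.exp_nat_mul]
    _ ≤ Real.exp (1 / 4) := Real.exp_le_exp.2 h
    _ ≤ 4 / 3 := by
        -- `exp(-1/4) ≥ 3/4`, inverted.
        have h1 := Real.add_one_le_exp (-(1 / 4) : ℝ)
        have h2 : Real.exp (1 / 4) * Real.exp (-(1 / 4)) = 1 := by
          rw [← Real.exp_add]; simp
        nlinarith [Real.exp_pos (1 / 4)]

/-- The bound on the condition number on a cube where neither `f` nor `∂f` dominates the radii of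
the centered forms. -/
theorem sqrt_eval_tangent_le_of_taylorRadius (hn : 1 ≤ n) (hd : 1 ≤ d)
    {f : MvPolynomial (Fin n) ℝ} (hdeg : f.totalDegree ≤ d) {J : Cube n}
    (hF : |evalAt f J.mid| ≤ taylorRadius f (fun i => J.mid i) J.width)
    (hG : ‖grad f J.mid‖ ≤
      5 / 2 * √(∑ i, taylorRadius (pderiv i f) (fun i => J.mid i) J.width ^ 2))
    {x : EuclideanSpace ℝ (Fin n)} (hx : x ∈ J.toSet) :
    √(evalAt (homogenize d f) (sphereMap x) ^ 2 +
        tangentNorm (homogenize d f) (sphereMap x) ^ 2 / d) ≤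
      (d ^ 2 * 8 ^ n) * J.width * affWeylNorm d f := by
  have hW := weylNorm_nonneg (homogenize d f)
  rw [affWeylNorm]
  have hw := J.width_pos
  have hn1 : (1 : ℝ) ≤ n := by exact_mod_cast hn
  have hd1 : (1 : ℝ) ≤ d := by exact_mod_cast hd
  have h8 := eight_mul_le_eight_pow hn
  have hsn : √(n : ℝ) ≤ n := by
    rw [Real.sqrt_le_left (by positivity)]
    nlinarith
  have hsd : √(d : ℝ) ≤ d := by
    rw [Real.sqrt_le_left (by positivity)]
    nlinarith
  set δ := √n * J.width with hδ
  have hδ0 : 0 ≤ δ := by positivity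
  have h8δ : 8 * δ ≤ 8 ^ n * J.width := by
    rw [hδ, ← mul_assoc]
    exact mul_le_mul_of_nonneg_right (by linarith) hw.le
  -- On a large cube the universal lower bound on `κ` suffices. On a small one `(1+δ)^(d-1)` stays
  -- bounded, so weights at `c` and at `x` are comparable.
  rcases lt_or_ge (1 / 4) (d * δ) with hbig | hsmall
  · refine (sqrt_eval_tangent_le_weylNorm hd (isHomogeneous_homogenize hdeg)
      (norm_sphereMap x)).trans (mul_le_mul_of_nonneg_right ?_ hW)
    have h1 : √(1 + (d : ℝ)) ≤ 2 * d := by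
      rw [Real.sqrt_le_left (by positivity)]
      nlinarith
    calc √(1 + (d : ℝ)) ≤ 2 * d := h1
      _ ≤ d * (8 * (d * δ)) := by nlinarith
      _ = d ^ 2 * (8 * δ) := by ring
      _ ≤ d ^ 2 * (8 ^ n * J.width) := by gcongr
      _ = _ := by ring
  · refine (sqrt_eval_tangent_le hd hdeg x).trans ?_
    set c := J.mid with hc
    set s := √(1 + ‖x‖ ^ 2) with hs
    have hs1 : 1 ≤ s := Real.one_le_sqrt.2 (by nlinarith [sq_nonneg ‖x‖])
    have hcx : ‖x - c‖ ≤ δ / 2 := by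
      have h := norm_le_sqrt_sum_sq (v := x - c) (ρ := fun _ => J.width / 2) (fun i => hx i)
      simp only [Finset.sum_const, Finset.card_univ, Fintype.card_fin, nsmul_eq_mul] at h
      rw [Real.sqrt_mul (by positivity), Real.sqrt_sq (by positivity)] at h
      rw [hδ]
      linarith
    have hw2 : √n * (J.width / 2) = δ / 2 := by rw [hδ]; ring
    set M := √(1 + ‖c‖ ^ 2) + δ / 2 with hM
    have hMle : M ≤ s * (1 + δ) := by
      have h1 : ‖c‖ ≤ ‖x‖ + δ / 2 := by
        have := norm_le_norm_add_norm_sub x c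
        linarith
      have h2 := sqrt_one_add_sq_le (by positivity) h1 (norm_nonneg c)
      rw [hM]
      nlinarith
    have hM0 : 0 ≤ M := by positivity
    have hpow : M ^ (d - 1) ≤ 4 / 3 * s ^ (d - 1) := by
      calc M ^ (d - 1) ≤ (s * (1 + δ)) ^ (d - 1) := pow_le_pow_left₀ hM0 hMle _
        _ = (1 + δ) ^ (d - 1) * s ^ (d - 1) := by rw [mul_pow, mul_comm]
        _ ≤ _ := by gcongr; exact one_add_pow_le hδ0 hsmall
    have hpow' : s * ((d - 1 : ℕ) * M ^ (d - 1 - 1)) ≤ d * (4 / 3 * s ^ (d - 1)) := by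
      -- For `d = 1` the truncated exponent `d - 1 - 1` is not `d - 2`, but the coefficient `d - 1`
      -- vanishes.
      rcases Nat.eq_zero_or_pos (d - 1) with h0 | hpos
      · rw [h0]
        simp only [Nat.cast_zero, zero_mul, mul_zero]
        positivity
      · have h1 : M ^ (d - 1 - 1) ≤ 4 / 3 * s ^ (d - 1 - 1) := by
          calc M ^ (d - 1 - 1) ≤ (s * (1 + δ)) ^ (d - 1 - 1) := pow_le_pow_left₀ hM0 hMle _
            _ = (1 + δ) ^ (d - 1 - 1) * s ^ (d - 1 - 1) := by rw [mul_pow, mul_comm]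
            _ ≤ (1 + δ) ^ (d - 1) * s ^ (d - 1 - 1) := by
                gcongr
                · linarith
                · exact Nat.sub_le _ _
            _ ≤ _ := by gcongr; exact one_add_pow_le hδ0 hsmall
        have h2 : s * s ^ (d - 1 - 1) = s ^ (d - 1) := by
          rw [← pow_succ', Nat.sub_add_cancel hpos]
        have h3 : ((d - 1 : ℕ) : ℝ) ≤ d := by exact_mod_cast Nat.sub_le d 1
        calc s * ((d - 1 : ℕ) * M ^ (d - 1 - 1))
            ≤ s * (d * (4 / 3 * s ^ (d - 1 - 1))) := by gcongr
          _ = d * (4 / 3 * (s * s ^ (d - 1 - 1))) := by ring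
          _ = _ := by rw [h2]
    have hR := sqrt_sum_sq_taylorRadius_pderiv_le hdeg c hw.le
    have hT := taylorRadius_le_weylNorm (isHomogeneous_homogenize hdeg) c hw.le
    have hFx : |evalAt f x| ≤ 2 * taylorRadius f (fun i => c i) J.width := by
      have h1 : |evalAt f x - evalAt f c| ≤ taylorRadius f (fun i => c i) J.width :=
        abs_eval_sub_eval_le_taylorRadius f hx
      have h2 := abs_sub_abs_le_abs_sub (evalAt f x) (evalAt f c)
      linarith
    have hGx : ‖grad f x‖ ≤
        7 / 2 * √(∑ i, taylorRadius (pderiv i f) (fun i => c i) J.width ^ 2) := by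
      have h1 := norm_le_sqrt_sum_sq (v := grad f x - grad f c) fun i =>
        abs_eval_sub_eval_le_taylorRadius (pderiv i f) hx
      have h2 := norm_le_norm_add_norm_sub' (grad f x) (grad f c)
      linarith
    set W := weylNorm (homogenize d f)
    rw [hw2, ← hM] at hR hT
    have hA : |evalAt f x| ≤ 4 / 3 * (W * (d * δ)) * s ^ (d - 1) := by
      calc |evalAt f x| ≤ 2 * (W * (d * M ^ (d - 1) * (δ / 2))) := by linarith
        _ ≤ 2 * (W * (d * (4 / 3 * s ^ (d - 1)) * (δ / 2))) := by gcongr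
        _ = _ := by ring
    have hG2 : s * ‖grad f x‖ / d ≤ 7 / 3 * (W * (d * δ)) * s ^ (d - 1) := by
      rw [div_le_iff₀ (by linarith)]
      calc s * ‖grad f x‖
          ≤ s * (7 / 2 * (d * W * ((d - 1 : ℕ) * M ^ (d - 1 - 1) * (δ / 2)))) := by
            gcongr
            linarith
        _ = 7 / 4 * (d * W * δ) * (s * ((d - 1 : ℕ) * M ^ (d - 1 - 1))) := by ring
        _ ≤ 7 / 4 * (d * W * δ) * (d * (4 / 3 * s ^ (d - 1))) := by gcongr
        _ = _ := by ring
    calc √d * ((|evalAt f x| + s * ‖grad f x‖ / d) / s ^ (d - 1))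
        ≤ d * (8 * (W * (d * δ))) := by
          gcongr
          -- The two estimates add up to `4/3 + 7/3 ≤ 8`.
          rw [div_le_iff₀ (by positivity)]
          have : 0 ≤ W * (d * δ) * s ^ (d - 1) := by positivity
          linarith
      _ = d ^ 2 * W * (8 * δ) := by ring
      _ ≤ d ^ 2 * W * (8 ^ n * J.width) := by gcongr
      _ = _ := by ring

theorem abs_evalAt_mid_le {f : MvPolynomial (Fin n) ℝ} {B : Cube n → Set ℝ} (hB : TaylorFun f B)
    {J : Cube n} (h : (0 : ℝ) ∈ B J) :
    |evalAt f J.mid| ≤ taylorRadius f (fun i => J.mid i) J.width := by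
  have := mem_taylorForm_iff.1 (hB J h)
  rwa [zero_sub, abs_neg] at this

theorem norm_grad_mid_le_of_inner {f : MvPolynomial (Fin n) ℝ}
    {D : Cube n → Set (EuclideanSpace ℝ (Fin n))} (hD : TaylorGrad f D) {J : Cube n}
    {u v : EuclideanSpace ℝ (Fin n)} (hu : u ∈ D J) (hv : v ∈ D J) (h : inner ℝ u v = 0) :
    ‖grad f J.mid‖ ≤
      5 / 2 * √(∑ i, taylorRadius (pderiv i f) (fun i => J.mid i) J.width ^ 2) :=
  norm_le_of_inner_eq_zero
    (norm_le_sqrt_sum_sq (v := u - grad f J.mid) fun i => mem_taylorForm_iff.1 (hD J u hu i))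
    (norm_le_sqrt_sum_sq (v := v - grad f J.mid) fun i => mem_taylorForm_iff.1 (hD J v hv i)) h

theorem norm_grad_mid_le_of_gradProd {f : MvPolynomial (Fin n) ℝ} {G : Cube n → Set ℝ}
    (hG : TaylorGradProd f G) {J : Cube n} (h : (0 : ℝ) ∈ G J) :
    ‖grad f J.mid‖ ≤
      5 / 2 * √(∑ i, taylorRadius (pderiv i f) (fun i => J.mid i) J.width ^ 2) := by
  refine le_mul_of_sq_le (Real.sqrt_nonneg _) ?_
  -- The midpoint of the centered form is `‖∂f(c)‖²`, so `0 ∈ G J` bounds it by the radius.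
  -- Cauchy–Schwarz then gives the quadratic inequality for `‖∂f(c)‖`.
  have h1 := (abs_le.1 (mem_taylorForm_iff.1 (hG J h))).1
  have h2 := taylorRadius_gradProd_le f (fun i => J.mid i) J.width_pos.le
  have h3 : eval (Sum.elim (fun i => J.mid i) fun i => J.mid i) (gradProd f) =
      ‖grad f J.mid‖ ^ 2 := by
    rw [EuclideanSpace.real_norm_sq_eq, gradProd, map_sum]
    refine Finset.sum_congr rfl fun i _ => ?_
    rw [map_mul, eval_rename, eval_rename, Sum.elim_comp_inl, Sum.elim_comp_inr, pow_two]
    rfl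
  have h4 : ∑ i, |eval (fun i => J.mid i) (pderiv i f)| *
      taylorRadius (pderiv i f) (fun i => J.mid i) J.width ≤ ‖grad f J.mid‖ *
        √(∑ i, taylorRadius (pderiv i f) (fun i => J.mid i) J.width ^ 2) := by
    rw [EuclideanSpace.norm_eq]
    exact Real.sum_mul_le_sqrt_mul_sqrt _ _ _
  have h5 : √(∑ i, taylorRadius (pderiv i f) (fun i => J.mid i) J.width ^ 2) ^ 2 =
      ∑ i, taylorRadius (pderiv i f) (fun i => J.mid i) J.width ^ 2 :=
    Real.sq_sqrt (Finset.sum_nonneg fun _ _ => sq_nonneg _)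
  rw [Finset.sum_add_distrib] at h2
  simp_rw [mul_assoc (2 : ℝ)] at h2
  rw [← Finset.mul_sum] at h2
  rw [h3] at h1
  rw [h5]
  linarith

/-! ### The constants -/

theorem ofReal_four_mul_pow_linearized (hn : 1 ≤ n) :
    ENNReal.ofReal ((4 * (4 * √2 * d * n)) ^ n) = (d : ℝ≥0∞) ^ n *
      ENNReal.ofReal ((2 : ℝ) ^ ((n : ℝ) * Real.logb 2 n + 9 * (n : ℝ) / 2)) := by
  have hn0 : (0 : ℝ) < n := by exact_mod_cast hn
  have h1 : (2 : ℝ) ^ ((n : ℝ) * Real.logb 2 n + 9 * (n : ℝ) / 2) =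
      (n * (4 * (4 * √2))) ^ n := by
    rw [show (n : ℝ) * Real.logb 2 n + 9 * (n : ℝ) / 2 = (Real.logb 2 n + 9 / 2) * n by ring,
      Real.rpow_mul (by norm_num), Real.rpow_natCast, Real.rpow_add (by norm_num),
      Real.rpow_logb (by norm_num) (by norm_num) hn0]
    congr 2
    rw [show (9 / 2 : ℝ) = (4 : ℕ) + 1 / 2 by norm_num, Real.rpow_add (by norm_num),
      Real.rpow_natCast, Real.sqrt_eq_rpow]
    norm_num
    ring
  rw [h1, ← ENNReal.ofReal_natCast, ← ENNReal.ofReal_pow (by positivity),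
    ← ENNReal.ofReal_mul (by positivity), ← mul_pow]
  congr 2
  ring

theorem ofReal_four_mul_pow_taylor :
    ENNReal.ofReal ((4 * ((d : ℝ) ^ 2 * 8 ^ n)) ^ n) =
      (d : ℝ≥0∞) ^ (2 * n) * (2 : ℝ≥0∞) ^ (3 * n ^ 2 + 2 * n) := by
  have h2 : (2 : ℝ≥0∞) = ENNReal.ofReal 2 := by simp
  rw [h2, ← ENNReal.ofReal_natCast, ← ENNReal.ofReal_pow (by positivity),
    ← ENNReal.ofReal_pow (by positivity), ← ENNReal.ofReal_mul (by positivity)]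
  congr 1
  have h4 : (4 : ℝ) ^ n = 2 ^ (2 * n) := by rw [pow_mul]; norm_num
  have h8 : ((8 : ℝ) ^ n) ^ n = 2 ^ (3 * n ^ 2) := by rw [pow_mul, pow_two, pow_mul]; norm_num
  rw [mul_pow, mul_pow, h4, h8, ← pow_mul, pow_add]
  ring

end PV

/-! ### The three bounds. -/

theorem theorem6p5 {n d : ℕ} (hn : 1 ≤ n) (hd : 1 ≤ d)
    (f : MvPolynomial (Fin n) ℝ) (hf : f ≠ 0) (hdeg : f.totalDegree ≤ d)
    (a : ℝ) (ha : 0 < a) :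
    (∀ (B : PV.Cube n → Set ℝ) (D : PV.Cube n → Set (EuclideanSpace ℝ (Fin n))),
      PV.IsIntervalApprox (PV.hatF d f) B → PV.IsIntervalApprox (PV.hatGrad d f) D →
      PV.FunBound d f B → PV.GradBound d f D →
      (PV.numCubes (PV.pvTest B D) (PV.rootCube n a ha) : ℝ≥0∞) ≤
        (d : ℝ≥0∞) ^ n * max 1 (ENNReal.ofReal (a ^ n)) *
          ENNReal.ofReal ((2 : ℝ) ^ ((n : ℝ) * Real.logb 2 n + 9 * (n : ℝ) / 2)) *
          PV.meanKappaPow d f a) ∧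
    (∀ (B : PV.Cube n → Set ℝ) (D : PV.Cube n → Set (EuclideanSpace ℝ (Fin n))),
      PV.IsIntervalApprox (PV.evalAt f) B → PV.IsIntervalApprox (PV.grad f) D →
      PV.TaylorFun f B → PV.TaylorGrad f D →
      (PV.numCubes (PV.pvTest B D) (PV.rootCube n a ha) : ℝ≥0∞) ≤
        (d : ℝ≥0∞) ^ (2 * n) * max 1 (ENNReal.ofReal (a ^ n)) *
          (2 : ℝ≥0∞) ^ (3 * n ^ 2 + 2 * n) * PV.meanKappaPow d f a) ∧
    (∀ B G : PV.Cube n → Set ℝ,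
      PV.IsIntervalApprox (PV.evalAt f) B → PV.IsGradProdApprox f G →
      PV.TaylorFun f B → PV.TaylorGradProd f G →
      (PV.numCubes (PV.prodTest B G) (PV.rootCube n a ha) : ℝ≥0∞) ≤
        (d : ℝ≥0∞) ^ (2 * n) * max 1 (ENNReal.ofReal (a ^ n)) *
          (2 : ℝ≥0∞) ^ (3 * n ^ 2 + 2 * n) * PV.meanKappaPow d f a) := by
  have hn1 : (1 : ℝ) ≤ n := by exact_mod_cast hn
  have hd1 : (1 : ℝ) ≤ d := by exact_mod_cast hd
  have hK : (d : ℝ) ≤ d ^ 2 * 8 ^ n := by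
    have h8 : (1 : ℝ) ≤ 8 ^ n := one_le_pow₀ (by norm_num)
    nlinarith [mul_le_mul_of_nonneg_left h8 (sq_nonneg (d : ℝ))]
  refine ⟨fun B D hB hD hB' hD' => ?_, fun B D _ _ hB' hD' => ?_, fun B G _ _ hB' hG' => ?_⟩
  · have hK' : (d : ℝ) ≤ 4 * √2 * d * n := by
      have h2 : (1 : ℝ) ≤ √2 := Real.one_le_sqrt.2 (by norm_num)
      calc (d : ℝ) = 1 * 1 * d * 1 := by ring
        _ ≤ 4 * √2 * d * n := by gcongr; norm_num
    refine (PV.numCubes_le_meanKappaPow hn hd hf hdeg ha hK' fun J hJ x hx =>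
      PV.sqrt_eval_tangent_le_of_not_pvTest_hat hn hd hf hdeg hB hD hB' hD' hJ hx).trans_eq ?_
    rw [PV.ofReal_four_mul_pow_linearized hn]
    ring
  · refine (PV.numCubes_le_meanKappaPow hn hd hf hdeg ha hK fun J hJ x hx => ?_).trans_eq ?_
    · simp only [PV.pvTest, not_or, not_not] at hJ
      obtain ⟨h0, u, hu, v, hv, huv⟩ := hJ
      exact PV.sqrt_eval_tangent_le_of_taylorRadius hn hd hdeg (PV.abs_evalAt_mid_le hB' h0)
        (PV.norm_grad_mid_le_of_inner hD' hu hv huv) hx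
    · rw [PV.ofReal_four_mul_pow_taylor]
      ring
  · refine (PV.numCubes_le_meanKappaPow hn hd hf hdeg ha hK fun J hJ x hx => ?_).trans_eq ?_
    · simp only [PV.prodTest, not_or, not_not] at hJ
      exact PV.sqrt_eval_tangent_le_of_taylorRadius hn hd hdeg (PV.abs_evalAt_mid_le hB' hJ.1)
        (PV.norm_grad_mid_le_of_gradProd hG' hJ.2) hx
    · rw [PV.ofReal_four_mul_pow_taylor]
      ring
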